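/- **Setting.** Let $n,m,H\ge 1$ and $T\ge 0$ be integers. Consider $x_{t+1}=Ax_t+Bu_t+w_t$, $x_0=0$, with $A\in\mathbb R^{n\times n}$, $B\in\mathbb R^{n\times m}$ and disturbances $w_t\in\mathcal W=\{w\in\mathbb R^n:\|w\|_\infty\le\bar w\}$; put $w_t=0$ for $t<0$. Let $\mathcal X\subseteq\mathbb R^n$, $\mathcal U\subseteq\mathbb R^m$ be closed convex sets containing the origin. For a set $\mathcal D$ and $\Delta\ge0$ let $\mathcal D_\Delta=\{x\in\mathcal D: x+y\in\mathcal D\ \text{for all } \|y\|_\infty\le\Delta\}$. The losses $c_t:\mathbb R^n\times\mathbb R^m\to\mathbb R$ are convex and differentiable, and there is a constant $G$ such that for every $D$, whenever $\|x\|_2,\|u\|_2\le D$, the quantities $|c_t(x,u)|$, $\|\nabla_xc_t(x,u)\|_2$, $\|\nabla_uc_t(x,u)\|_2$ are at most $GD$. Let $\kappa>1$, $\gamma\in(0,1]$. A matrix $K\in\mathbb R^{m\times n}$ is $(\kappa,\gamma)$-strongly stable if $A-BK=SLS^{-1}$ for some real matrices $L$ and invertible $S$ with $\|L\|_2\le1-\gamma$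 and $\|K\|_2,\|S\|_2,\|S^{-1}\|_2\le\kappa$. Put $\kappa_B=\max\{\|B\|_2,1\}$. Write $x_t^K,u_t^K$ for the trajectory under $u_t=-Kx_t$, and let $\mathcal K$ be the set of $(\kappa,\gamma)$-strongly stable $K$ with $x^K_t\in\mathcal X$, $u^K_t\in\mathcal U$ for all $0\le t\le T$ and all disturbances in $\mathcal W$. Assume that some $K_{ss}\in\mathcal K$ and some $\epsilon_*>0$ satisfy $x_t^{K_{ss}}\in\mathcal X_{\epsilon_*}$, $u_t^{K_{ss}}\in\mathcal U_{\epsilon_*}$ for all $t\ge0$ and all disturbance sequences in $\mathcal W$. **Algorithm (OGD-BZC).** Fix a $(\kappa,\gamma)$-strongly stable $K$, $\eta>0$, $\epsilon\ge0$, and $a\ge2\kappa^3$ (for instance $a=2\kappa^3$). For $\boldsymbol M=(\boldsymbol M^{[1]},\dots,\boldsymbol M^{[H]})$ with $\boldsymbol M^{[i]}\in\mathbb R^{m\times n}$ and $1\le k\le2H$ put, with $A_K=A-BK$, $$\Psi^x_k=A_K^{k-1}\mathbf 1_{k\le H}+\sum_{i=1}^HA_K^{i-1}B\boldsymbol M^{[k-i]}\mathbf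 1_{1\le k-i\le H},\qquad \Psi^u_k=\boldsymbol M^{[k]}\mathbf 1_{k\le H}-K\Psi^x_k .$$ Let $\Omega^\epsilon$ be the set of all $\boldsymbol M$ with $\|\boldsymbol M^{[i]}\|_2\le a(1-\gamma)^{i-1}$ for $1\le i\le H$ such that $\sum_{k=1}^{2H}\Psi^x_kv_k\in\mathcal X_\epsilon$ and $\sum_{k=1}^{2H}\Psi^u_kv_k\in\mathcal U_\epsilon$ for all $v_1,\dots,v_{2H}\in\mathcal W$, and let $\mathring f_t(\boldsymbol M)=c_t\big(\sum_{k=1}^{2H}\Psi^x_kw_{t-k},\sum_{k=1}^{2H}\Psi^u_kw_{t-k}\big)$. The algorithm starts at some $\boldsymbol M_0\in\Omega^\epsilon$, plays $u_t=-Kx_t+\sum_{i=1}^H\boldsymbol M_t^{[i]}w_{t-i}$ and updates $\boldsymbol M_{t+1}=\Pi_{\Omega^\epsilon}[\boldsymbol M_t-\eta\nabla\mathring f_t(\boldsymbol M_t)]$, where $\Pi_{\Omega^\epsilon}$ is the projection onto $\Omega^\epsilon$ in the Frobenius norm. With $x_t,u_t$ its states and inputs, its regret is $$\mathrm{Reg}_T=\sup_{\{w_k\}\subset\mathcal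 W}\Big(\sum_{t=0}^Tc_t(x_t,u_t)-\inf_{K'\in\mathcal K}\sum_{t=0}^Tc_t(x_t^{K'},u_t^{K'})\Big).$$ **Theorem.** Let $$\epsilon_1=c_1H(1-\gamma)^H,\qquad \epsilon_2=c_2\sqrt{mn^3}\,\eta H^2,\qquad \epsilon_3=c_3\sqrt n(1-\gamma)^H$$ with $c_1=\bar w\kappa^3(2\kappa^3+2a\kappa^3\kappa_B+a)/\gamma$, $c_2=4G\bar w^3(\kappa^3+2a\kappa^3\kappa_B)(1+\kappa)\kappa^5\kappa_B^2/\gamma^4$, $c_3=2\bar w\kappa^5$. Suppose $$H\ge\frac{\log(2\kappa^2)}{\log((1-\gamma)^{-1})},\qquad \epsilon_1+\epsilon_2\le\epsilon\le\epsilon_*-\epsilon_1-\epsilon_3,\qquad \epsilon<\frac{\epsilon_*}2-\epsilon_1-\epsilon_3$$ (the first condition being void if $\gamma=1$). Then $$\mathrm{Reg}_T\le C\Big(T\sqrt{m^2n^3}H^2(1-\gamma)^H+Tmn^2H^3\eta+\frac m\eta+\frac{T(1-\gamma)^H\sqrt{m^2n^3H^5}}{\epsilon_*}+\frac{\epsilon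 T\sqrt{m^2n^2H^3}}{\epsilon_*}\Big),$$ where $C=P(\bar w,G,\kappa,\kappa_B,a,\gamma^{-1})$ for a polynomial $P$ that does not depend on any of the data. -/

import Mathlib

namespace OGDBZC

noncomputable section

/-- Column vectors, with the Euclidean norm. -/
abbrev Vec (n : ℕ) := EuclideanSpace ℝ (Fin n)

/-- The action of a matrix on column vectors. -/
def act {p q : ℕ} (M : Matrix (Fin p) (Fin q) ℝ) (x : Vec q) : Vec p :=
  Matrix.toEuclideanLin M x

/-- The spectral norm of a matrix (operator norm for the Euclidean norms). -/
def opNorm {p q : ℕ} (M : Matrix (Fin p) (Fin q) ℝ) : ℝ :=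
  ‖LinearMap.toContinuousLinearMap (Matrix.toEuclideanLin M)‖

/-- The closed ball of radius `r` about `0` for the maximum norm. -/
def boxBall (d : ℕ) (r : ℝ) : Set (Vec d) := {y | ∀ i, |y i| ≤ r}

/-- The `Δ`-shrinkage of a set in the maximum norm, for `Δ ≥ 0`. -/
def shrink {d : ℕ} (D : Set (Vec d)) (Δ : ℝ) : Set (Vec d) :=
  {x | x ∈ D ∧ ∀ y ∈ boxBall d Δ, x + y ∈ D}

/-- Disturbance sequences with all values in the box `‖w‖_∞ ≤ wbar`. -/
def Disturbances (n : ℕ) (wbar : ℝ) : Set (ℕ → Vec n) :=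
  {w | ∀ t, w t ∈ boxBall n wbar}

/-- The disturbance `w_{t-k}`, with the convention `w_s = 0` for `s < 0`. -/
def past {n : ℕ} (w : ℕ → Vec n) (t k : ℕ) : Vec n :=
  if k ≤ t then w (t - k) else 0

/-! ### Closed-loop trajectories, safety, strong stability -/

/-- The state `x_t` of `x_{t+1} = A x_t + B u_t + w_t`, `x_0 = 0`, when `u_t = π t x_t`. -/
def state {n m : ℕ} (A : Matrix (Fin n) (Fin n) ℝ) (B : Matrix (Fin n) (Fin m) ℝ)
    (w : ℕ → Vec n) (π : ℕ → Vec n → Vec m) : ℕ → Vec n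
  | 0 => 0
  | t + 1 => act A (state A B w π t) + act B (π t (state A B w π t)) + w t

/-- The control input `u_t = π t x_t` along the trajectory. -/
def input {n m : ℕ} (A : Matrix (Fin n) (Fin n) ℝ) (B : Matrix (Fin n) (Fin m) ℝ)
    (w : ℕ → Vec n) (π : ℕ → Vec n → Vec m) (t : ℕ) : Vec m :=
  π t (state A B w π t)

/-- The linear policy `u_t = -K x_t`. -/
def linPolicy {n m : ℕ} (K : Matrix (Fin m) (Fin n) ℝ) : ℕ → Vec n → Vec m :=
  fun _ x => -act K x

/-- `u_t = -K x_t` is `(κ, γ)`-strongly stable. -/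
def StronglyStable {n m : ℕ} (A : Matrix (Fin n) (Fin n) ℝ) (B : Matrix (Fin n) (Fin m) ℝ)
    (κ γ : ℝ) (K : Matrix (Fin m) (Fin n) ℝ) : Prop :=
  ∃ L S : Matrix (Fin n) (Fin n) ℝ, IsUnit S ∧ A - B * K = S * L * S⁻¹ ∧
    opNorm L ≤ 1 - γ ∧ opNorm K ≤ κ ∧ opNorm S ≤ κ ∧ opNorm S⁻¹ ≤ κ

/-- `κ_B = max {‖B‖₂, 1}`. -/
def kappaB {n m : ℕ} (B : Matrix (Fin n) (Fin m) ℝ) : ℝ := max (opNorm B) 1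

/-- The benchmark class: `(κ, γ)`-strongly stable linear policies that are safe at all times
`0 ≤ t ≤ T` under all admissible disturbances. -/
def safeLinear {n m : ℕ} (A : Matrix (Fin n) (Fin n) ℝ) (B : Matrix (Fin n) (Fin m) ℝ)
    (wbar : ℝ) (X : Set (Vec n)) (U : Set (Vec m)) (κ γ : ℝ) (T : ℕ) :
    Set (Matrix (Fin m) (Fin n) ℝ) :=
  {K | StronglyStable A B κ γ K ∧ ∀ w ∈ Disturbances n wbar, ∀ t ≤ T,
    state A B w (linPolicy K) t ∈ X ∧ input A B w (linPolicy K) t ∈ U}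

/-- `u_t = -K x_t` is `ε`-strictly safe over the infinite horizon. -/
def StrictlySafe {n m : ℕ} (A : Matrix (Fin n) (Fin n) ℝ) (B : Matrix (Fin n) (Fin m) ℝ)
    (wbar : ℝ) (X : Set (Vec n)) (U : Set (Vec m)) (ε : ℝ)
    (K : Matrix (Fin m) (Fin n) ℝ) : Prop :=
  ∀ w ∈ Disturbances n wbar, ∀ t,
    state A B w (linPolicy K) t ∈ shrink X ε ∧ input A B w (linPolicy K) t ∈ shrink U ε

/-- Assumption on the losses: jointly convex and differentiable, with value and partial
gradients at most `G * D` on `‖x‖ ≤ D`, `‖u‖ ≤ D`, for every `D`. -/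
def LossAssumption {n m : ℕ} (c : ℕ → Vec n → Vec m → ℝ) (G : ℝ) : Prop :=
  ∀ t, ConvexOn ℝ Set.univ (fun p : Vec n × Vec m => c t p.1 p.2) ∧
    Differentiable ℝ (fun p : Vec n × Vec m => c t p.1 p.2) ∧
    ∀ (D : ℝ) (x : Vec n) (u : Vec m), ‖x‖ ≤ D → ‖u‖ ≤ D →
      |c t x u| ≤ G * D ∧
      ‖gradient (fun x' => c t x' u) x‖ ≤ G * D ∧
      ‖gradient (fun u' => c t x u') u‖ ≤ G * D

/-- The cumulative loss `∑_{t=0}^T c_t(x_t, u_t)` of a policy. -/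
def cumLoss {n m : ℕ} (A : Matrix (Fin n) (Fin n) ℝ) (B : Matrix (Fin n) (Fin m) ℝ)
    (c : ℕ → Vec n → Vec m → ℝ) (T : ℕ) (w : ℕ → Vec n) (π : ℕ → Vec n → Vec m) : ℝ :=
  ∑ t ∈ Finset.range (T + 1), c t (state A B w π t) (input A B w π t)

/-- The regret over `0 ≤ t ≤ T` of an algorithm `alg`, which turns a disturbance sequence into
the sequence of feedback laws that it plays: the supremum over disturbances of its loss minus
the infimum of the losses over the benchmark class. It is formed in the extended reals, so that
suprema and infima always have their genuine value. -/
def regret {n m : ℕ} (A : Matrix (Fin n) (Fin n) ℝ) (B : Matrix (Fin n) (Fin m) ℝ)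
    (wbar : ℝ) (X : Set (Vec n)) (U : Set (Vec m)) (κ γ : ℝ)
    (c : ℕ → Vec n → Vec m → ℝ) (T : ℕ)
    (alg : (ℕ → Vec n) → ℕ → Vec n → Vec m) : EReal :=
  ⨆ w ∈ Disturbances n wbar,
    ((cumLoss A B c T w (alg w) : ℝ) : EReal) -
      ⨅ K ∈ safeLinear A B wbar X U κ γ T, ((cumLoss A B c T w (linPolicy K) : ℝ) : EReal)

/-! ### Disturbance-action controllers -/

/-- Weights `(M^{[1]}, …, M^{[H]})`, each an `m × n` matrix; the Hilbert norm is the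
Frobenius norm. -/
abbrev Weights (H m n : ℕ) := EuclideanSpace ℝ (Fin H × Fin m × Fin n)

/-- The matrix `M^{[i]}` for `1 ≤ i ≤ H` (and `0` for other `i`). -/
def blk {H m n : ℕ} (M : Weights H m n) (i : ℕ) : Matrix (Fin m) (Fin n) ℝ :=
  if h : 1 ≤ i ∧ i ≤ H then Matrix.of fun r s => M (⟨i - 1, by omega⟩, r, s) else 0

/-- The class `ℳ`: `‖M^{[i]}‖₂ ≤ a (1 - γ)^{i-1}` for `1 ≤ i ≤ H`. -/
def weightClass (H m n : ℕ) (a γ : ℝ) : Set (Weights H m n) :=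
  {M | ∀ i ∈ Finset.Icc 1 H, opNorm (blk M i) ≤ a * (1 - γ) ^ (i - 1)}

/-- The disturbance-to-state matrix `Ψ_k^x` of a constant weight `M`. The condition on `i` in
the sum is `1 ≤ k - i ≤ H`. -/
def psiX {H n m : ℕ} (A : Matrix (Fin n) (Fin n) ℝ) (B : Matrix (Fin n) (Fin m) ℝ)
    (K : Matrix (Fin m) (Fin n) ℝ) (M : Weights H m n) (k : ℕ) : Matrix (Fin n) (Fin n) ℝ :=
  (if k ≤ H then (A - B * K) ^ (k - 1) else 0) +
    ∑ i ∈ Finset.Icc 1 H,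
      if i + 1 ≤ k ∧ k ≤ i + H then (A - B * K) ^ (i - 1) * B * blk M (k - i) else 0

/-- The disturbance-to-response matrix `Ψ_k^u` of a constant weight `M`. -/
def psiU {H n m : ℕ} (A : Matrix (Fin n) (Fin n) ℝ) (B : Matrix (Fin n) (Fin m) ℝ)
    (K : Matrix (Fin m) (Fin n) ℝ) (M : Weights H m n) (k : ℕ) : Matrix (Fin m) (Fin n) ℝ :=
  (if k ≤ H then blk M k else 0) - K * psiX A B K M k

/-- The map `(v_1, …, v_{2H}) ↦ ∑_k Ψ_k^x v_k`. -/
def surrState {H n m : ℕ} (A : Matrix (Fin n) (Fin n) ℝ) (B : Matrix (Fin n) (Fin m) ℝ)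
    (K : Matrix (Fin m) (Fin n) ℝ) (M : Weights H m n) (v : ℕ → Vec n) : Vec n :=
  ∑ k ∈ Finset.Icc 1 (2 * H), act (psiX A B K M k) (v k)

/-- The map `(v_1, …, v_{2H}) ↦ ∑_k Ψ_k^u v_k`. -/
def surrInput {H n m : ℕ} (A : Matrix (Fin n) (Fin n) ℝ) (B : Matrix (Fin n) (Fin m) ℝ)
    (K : Matrix (Fin m) (Fin n) ℝ) (M : Weights H m n) (v : ℕ → Vec n) : Vec m :=
  ∑ k ∈ Finset.Icc 1 (2 * H), act (psiU A B K M k) (v k)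

/-- The safe policy set `Ω^ε`. -/
def safeSet {H n m : ℕ} (A : Matrix (Fin n) (Fin n) ℝ) (B : Matrix (Fin n) (Fin m) ℝ)
    (K : Matrix (Fin m) (Fin n) ℝ) (wbar : ℝ) (X : Set (Vec n)) (U : Set (Vec m))
    (a γ ε : ℝ) : Set (Weights H m n) :=
  {M | M ∈ weightClass H m n a γ ∧ ∀ v : ℕ → Vec n, (∀ k, v k ∈ boxBall n wbar) →
    surrState A B K M v ∈ shrink X ε ∧ surrInput A B K M v ∈ shrink U ε}

/-- The approximate cost: the loss at the surrogate state and input that the constant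
weight `M` produces at time `t` from the disturbances `w_{t-1}, …, w_{t-2H}`. -/
def approxCost {H n m : ℕ} (A : Matrix (Fin n) (Fin n) ℝ) (B : Matrix (Fin n) (Fin m) ℝ)
    (K : Matrix (Fin m) (Fin n) ℝ) (c : ℕ → Vec n → Vec m → ℝ) (w : ℕ → Vec n) (t : ℕ)
    (M : Weights H m n) : ℝ :=
  c t (surrState A B K M (past w t)) (surrInput A B K M (past w t))

/-! ### The algorithm -/

/-- The metric projection onto `S`: a point of `S` nearest to `y` (it exists and is unique if
`S` is non-empty, closed and convex). -/
def proj {E : Type*} [NormedAddCommGroup E] (S : Set E) (y : E) : E :=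
  have : Nonempty E := ⟨0⟩
  Classical.epsilon fun z => z ∈ S ∧ ∀ s ∈ S, ‖y - z‖ ≤ ‖y - s‖

/-- The weights of the algorithm: projected online gradient descent
`M_{t+1} = Π [M_t - η ∇ f_t(M_t)]` on the safe policy set, started at `M0`. -/
def ogdWeights {H n m : ℕ} (A : Matrix (Fin n) (Fin n) ℝ) (B : Matrix (Fin n) (Fin m) ℝ)
    (K : Matrix (Fin m) (Fin n) ℝ) (wbar : ℝ) (X : Set (Vec n)) (U : Set (Vec m))
    (a γ ε η : ℝ) (c : ℕ → Vec n → Vec m → ℝ) (M0 : Weights H m n) (w : ℕ → Vec n) :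
    ℕ → Weights H m n
  | 0 => M0
  | t + 1 => proj (safeSet A B K wbar X U a γ ε)
      (ogdWeights A B K wbar X U a γ ε η c M0 w t -
        η • gradient (approxCost A B K c w t) (ogdWeights A B K wbar X U a γ ε η c M0 w t))

/-- OGD-BZC: the control `u_t = -K x_t + ∑_{i=1}^H M_t^{[i]} w_{t-i}` with the weights above. -/
def ogdBZC {H n m : ℕ} (A : Matrix (Fin n) (Fin n) ℝ) (B : Matrix (Fin n) (Fin m) ℝ)
    (K : Matrix (Fin m) (Fin n) ℝ) (wbar : ℝ) (X : Set (Vec n)) (U : Set (Vec m))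
    (a γ ε η : ℝ) (c : ℕ → Vec n → Vec m → ℝ) (M0 : Weights H m n) (w : ℕ → Vec n) :
    ℕ → Vec n → Vec m :=
  fun t x => -act K x + ∑ i ∈ Finset.Icc 1 H,
    act (blk (ogdWeights A B K wbar X U a γ ε η c M0 w t) i) (past w t i)

/-! ### The buffer constants -/

/-- `ε₁(H) = c₁ H (1 - γ)^H`. -/
def eps1 (wbar κ κB a γ : ℝ) (H : ℕ) : ℝ :=
  (wbar * κ ^ 3 * (2 * κ ^ 3 + 2 * a * κ ^ 3 * κB + a) / γ) * H * (1 - γ) ^ H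

/-- `ε₂(η, H) = c₂ √(m n³) η H²`. -/
def eps2 (n m : ℕ) (wbar G κ κB a γ η : ℝ) (H : ℕ) : ℝ :=
  (4 * G * wbar ^ 3 * (κ ^ 3 + 2 * a * κ ^ 3 * κB) * (1 + κ) * κ ^ 5 * κB ^ 2 / γ ^ 4) *
    Real.sqrt ((m : ℝ) * (n : ℝ) ^ 3) * η * (H : ℝ) ^ 2

/-- `ε₃(H) = c₃ √n (1 - γ)^H`. -/
def eps3 (n : ℕ) (wbar κ γ : ℝ) (H : ℕ) : ℝ :=
  (2 * wbar * κ ^ 5) * Real.sqrt n * (1 - γ) ^ H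

end

end OGDBZC

open OGDBZC

open OGDBZC

/-! Write ρ = 1 - γ, and fix a disturbance sequence and a benchmark gain K'. Since -K'x = -Kx + (K -
K')x, and the state under K' is a geometric sum of past disturbances, the weights (K - K')(A -
BK')^{i-1} reproduce K' as disturbance-action control around K, up to an error of order ρ^H from the
truncated memory (`norm_state_linPolicy_sub_surrState_le`, `norm_input_linPolicy_sub_surrInput_le`).

These weights need not meet the constraints tightened by ε. They are therefore mixed, in proportion
l = (ε + truncation error)/ε_*, with the weights imitating K_ss: the margin ε_* of K_ss, scaled by
l, pays for ε and for the truncation (`combination_mem_shrink`,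
`imitation_combination_mem_safeSet`). By convexity the mixing costs O(l) per round, which produces
the two terms with 1/ε_*.

The mixture is then a fixed comparator in Ω^ε, and the regret splits into four comparisons, added up
in `cumLoss_ogd_sub_le`. The true loss is near the approximate cost of the current weight, because
the weights move by at most η times a gradient bound per step and history older than H is damped by
ρ^H (`cost_sub_approxCost_le`). Projected gradient descent controls the approximate costs against
the mixture (`sum_inner_le_of_descent`). The mixture is compared with the weights imitating K', and
these with K' itself.

The mixture is available only if l ≤ 1 and 2H ≤ T. Otherwise the crude bound
`cumLoss_dacPolicy_sub_le` suffices: for l > 1 it lies below the mixing cost, and for T < 2H below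
the two step-size terms, by the arithmetic-geometric mean inequality. A single Q ≥ 1 dominates all
problem constants, so every estimate is a power of Q times powers of n, m, H, η and ρ^H. -/

namespace OGDBZC

open Finset
open scoped RealInnerProductSpace

/-! ### Matrices acting on Euclidean vectors and the spectral norm -/

section Act

variable {p q r : ℕ}

lemma act_add (M : Matrix (Fin p) (Fin q) ℝ) (x y : Vec q) :
    act M (x + y) = act M x + act M y := map_add _ _ _

lemma act_sub (M : Matrix (Fin p) (Fin q) ℝ) (x y : Vec q) :
    act M (x - y) = act M x - act M y := map_sub _ _ _

lemma act_neg (M : Matrix (Fin p) (Fin q) ℝ) (x : Vec q) : act M (-x) = -act M x := map_neg _ _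

@[simp] lemma act_zero (M : Matrix (Fin p) (Fin q) ℝ) : act M 0 = 0 := map_zero _

lemma act_sum {ι : Type*} (M : Matrix (Fin p) (Fin q) ℝ) (s : Finset ι) (f : ι → Vec q) :
    act M (∑ i ∈ s, f i) = ∑ i ∈ s, act M (f i) := map_sum _ _ _

lemma add_act (M N : Matrix (Fin p) (Fin q) ℝ) (x : Vec q) :
    act (M + N) x = act M x + act N x := by simp [act]

lemma sub_act (M N : Matrix (Fin p) (Fin q) ℝ) (x : Vec q) :
    act (M - N) x = act M x - act N x := by simp [act]

lemma smul_act (s : ℝ) (M : Matrix (Fin p) (Fin q) ℝ) (x : Vec q) :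
    act (s • M) x = s • act M x := by simp [act]

@[simp] lemma zero_act (x : Vec q) : act (0 : Matrix (Fin p) (Fin q) ℝ) x = 0 := by simp [act]

lemma sum_act {ι : Type*} (s : Finset ι) (M : ι → Matrix (Fin p) (Fin q) ℝ) (x : Vec q) :
    act (∑ i ∈ s, M i) x = ∑ i ∈ s, act (M i) x := by simp [act]

@[simp] lemma one_act (x : Vec q) : act (1 : Matrix (Fin q) (Fin q) ℝ) x = x := by
  ext i; simp [act]

lemma mul_act (M : Matrix (Fin p) (Fin q) ℝ) (N : Matrix (Fin q) (Fin r) ℝ) (x : Vec r) :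
    act (M * N) x = act M (act N x) := by
  ext i; simp [act, Matrix.toLpLin_apply, Matrix.mulVec_mulVec]

lemma act_apply (M : Matrix (Fin p) (Fin q) ℝ) (x : Vec q) (i : Fin p) :
    act M x i = ∑ j, M i j * x j := by
  simp [act, Matrix.toLpLin_apply, Matrix.mulVec, dotProduct]

lemma opNorm_nonneg (M : Matrix (Fin p) (Fin q) ℝ) : 0 ≤ opNorm M := norm_nonneg _

lemma norm_act_le (M : Matrix (Fin p) (Fin q) ℝ) (x : Vec q) : ‖act M x‖ ≤ opNorm M * ‖x‖ :=
  (LinearMap.toContinuousLinearMap (Matrix.toEuclideanLin M)).le_opNorm x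

lemma norm_act_le_of_le {M : Matrix (Fin p) (Fin q) ℝ} {C : ℝ} (h : opNorm M ≤ C) (x : Vec q) :
    ‖act M x‖ ≤ C * ‖x‖ :=
  (norm_act_le M x).trans (mul_le_mul_of_nonneg_right h (norm_nonneg x))

lemma opNorm_le_of_forall {M : Matrix (Fin p) (Fin q) ℝ} {C : ℝ} (hC : 0 ≤ C)
    (h : ∀ x, ‖act M x‖ ≤ C * ‖x‖) : opNorm M ≤ C :=
  ContinuousLinearMap.opNorm_le_bound _ hC h

lemma norm_act_pow_le {M : Matrix (Fin q) (Fin q) ℝ} {C : ℝ} (h : opNorm M ≤ C) (k : ℕ)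
    (x : Vec q) : ‖act (M ^ k) x‖ ≤ C ^ k * ‖x‖ := by
  have hC := (opNorm_nonneg M).trans h
  induction k with
  | zero => simp
  | succ k ih =>
    rw [pow_succ', mul_act, pow_succ', mul_assoc]
    exact (norm_act_le_of_le h _).trans (mul_le_mul_of_nonneg_left ih hC)

/-- A row of a matrix is at most as long as the spectral norm. -/
lemma sum_row_sq_le (M : Matrix (Fin p) (Fin q) ℝ) (i : Fin p) :
    ∑ j, M i j ^ 2 ≤ opNorm M ^ 2 := by
  -- Apply the matrix to its own row: the `i`-th entry of the result is `‖v‖ ^ 2`.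
  set v : Vec q := WithLp.toLp 2 (M i)
  have hv : ‖v‖ ^ 2 = ∑ j, M i j ^ 2 := by
    rw [EuclideanSpace.norm_sq_eq]; simp [v]
  have h1 : act M v i = ‖v‖ ^ 2 := by
    rw [act_apply, hv]; simp [v, pow_two]
  have h2 : ‖v‖ ^ 2 ≤ opNorm M * ‖v‖ := by
    rw [← h1]
    exact (le_abs_self _).trans ((PiLp.norm_apply_le (act M v) i).trans (norm_act_le M v))
  rw [← hv]
  have h3 : ‖v‖ ≤ opNorm M := by
    rcases (norm_nonneg v).eq_or_lt with h | h
    · rw [← h]; exact opNorm_nonneg M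
    · nlinarith
  gcongr

end Act

/-! ### The disturbance box, delayed disturbances and geometric sums -/

section Box

lemma norm_le_of_mem_boxBall {d : ℕ} {r : ℝ} (hr : 0 ≤ r) {y : Vec d} (hy : y ∈ boxBall d r) :
    ‖y‖ ≤ Real.sqrt d * r := by
  rw [EuclideanSpace.norm_eq]
  apply Real.sqrt_le_iff.2
  refine ⟨by positivity, ?_⟩
  rw [mul_pow, Real.sq_sqrt (by positivity)]
  calc ∑ i, ‖y i‖ ^ 2 ≤ ∑ _i : Fin d, r ^ 2 := by
        gcongr with i
        exact hy i
    _ = d * r ^ 2 := by simp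

lemma zero_mem_boxBall {d : ℕ} {r : ℝ} (hr : 0 ≤ r) : (0 : Vec d) ∈ boxBall d r :=
  fun i => by simpa using hr

end Box

section Past

variable {n : ℕ}

lemma past_succ (w : ℕ → Vec n) (t k : ℕ) : past w (t + 1) (k + 1) = past w t k := by
  simp [past]

lemma past_of_le (w : ℕ → Vec n) {t k : ℕ} (h : k ≤ t) : past w t k = w (t - k) := if_pos h

lemma past_of_lt (w : ℕ → Vec n) {t k : ℕ} (h : t < k) : past w t k = 0 := if_neg (by omega)

lemma past_add (w : ℕ → Vec n) {t i : ℕ} (h : i ≤ t) (j : ℕ) :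
    past w t (i + j) = past w (t - i) j := by
  unfold past
  by_cases h' : i + j ≤ t
  · rw [if_pos h', if_pos (by omega)]; congr 1; omega
  · rw [if_neg h', if_neg (by omega)]

lemma norm_past_le {w : ℕ → Vec n} {b : ℝ} (hw : ∀ t, ‖w t‖ ≤ b) (t k : ℕ) : ‖past w t k‖ ≤ b := by
  unfold past
  split_ifs
  · exact hw _
  · simpa using (norm_nonneg _).trans (hw 0)

end Past

section Sums

lemma sum_Icc_one_eq_sum_range {E : Type*} [AddCommMonoid E] (f : ℕ → E) (N : ℕ) :
    ∑ i ∈ Icc 1 N, f i = ∑ i ∈ range N, f (i + 1) := by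
  rw [Finset.range_eq_Ico, Finset.sum_Ico_add' f 0 N 1]
  rfl

lemma norm_sum_geom_le {E : Type*} [SeminormedAddCommGroup E] {ρ Q C : ℝ} (hC : 0 ≤ C)
    (hgeom : ∀ N, ∑ i ∈ range N, ρ ^ i ≤ Q) (N : ℕ) (f : ℕ → E)
    (hf : ∀ i < N, ‖f i‖ ≤ C * ρ ^ i) : ‖∑ i ∈ range N, f i‖ ≤ C * Q := by
  calc ‖∑ i ∈ range N, f i‖ ≤ ∑ i ∈ range N, C * ρ ^ i :=
        norm_sum_le_of_le _ fun i hi => hf i (mem_range.1 hi)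
    _ = C * ∑ i ∈ range N, ρ ^ i := by rw [mul_sum]
    _ ≤ C * Q := mul_le_mul_of_nonneg_left (hgeom N) hC

lemma sum_pow_one_sub_le {γ : ℝ} (hγ : 0 < γ) (hγ1 : γ ≤ 1) (N : ℕ) :
    ∑ i ∈ range N, (1 - γ) ^ i ≤ γ⁻¹ := by
  have h := geom_sum_mul (1 - γ) N
  have h2 : 0 ≤ (1 - γ) ^ N := pow_nonneg (by linarith) N
  rw [← one_div, le_div_iff₀ hγ]
  nlinarith

end Sums

/-! ### Weights, their blocks and the disturbance-action term -/

section Blocks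

variable {H m n : ℕ}

lemma blk_succ (M : Weights H m n) {i : ℕ} (hi : i < H) (r : Fin m) (s : Fin n) :
    blk M (i + 1) r s = M (⟨i, hi⟩, r, s) := by
  simp [blk, hi]

lemma blk_add (M N : Weights H m n) (i : ℕ) : blk (M + N) i = blk M i + blk N i := by
  unfold blk
  split_ifs
  · ext; simp
  · simp

lemma blk_smul (s : ℝ) (M : Weights H m n) (i : ℕ) : blk (s • M) i = s • blk M i := by
  unfold blk
  split_ifs
  · ext; simp
  · simp

lemma blk_sub (M N : Weights H m n) (i : ℕ) : blk (M - N) i = blk M i - blk N i := by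
  unfold blk
  split_ifs
  · ext; simp
  · simp

/-- Cauchy-Schwarz on each row bounds the spectral norm of a block by its Frobenius norm, and one
block is part of the whole weight. -/
lemma norm_act_blk_le (M : Weights H m n) (i : ℕ) (x : Vec n) :
    ‖act (blk M i) x‖ ≤ ‖M‖ * ‖x‖ := by
  unfold blk
  split_ifs with h
  · have key : ‖act (Matrix.of fun r s => M (⟨i - 1, by omega⟩, r, s)) x‖ ^ 2
        ≤ (‖M‖ * ‖x‖) ^ 2 := by
      rw [mul_pow, EuclideanSpace.norm_sq_eq, EuclideanSpace.norm_sq_eq M]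
      calc _ ≤ ∑ r, (∑ s, M (⟨i - 1, by omega⟩, r, s) ^ 2) * ‖x‖ ^ 2 := by
            gcongr with r
            rw [act_apply, EuclideanSpace.norm_sq_eq]
            simp only [Real.norm_eq_abs, sq_abs, Matrix.of_apply]
            exact sum_mul_sq_le_sq_mul_sq _ _ _
        _ = (∑ r, ∑ s, M (⟨i - 1, by omega⟩, r, s) ^ 2) * ‖x‖ ^ 2 := by rw [sum_mul]
        _ ≤ _ := by
            gcongr
            simp only [Real.norm_eq_abs, sq_abs]
            rw [Fintype.sum_prod_type]
            simp_rw [Fintype.sum_prod_type]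
            exact single_le_sum (f := fun j : Fin H => ∑ r, ∑ s, M (j, r, s) ^ 2)
              (fun _ _ => by positivity) (mem_univ _)
    exact le_of_sq_le_sq key (by positivity)
  · simp; positivity

/-- The Frobenius norm of a weight in `ℳ`. -/
lemma norm_sq_le_of_mem_weightClass {a γ Q : ℝ} (hγ : 0 ≤ 1 - γ) (hγ1 : 1 - γ ≤ 1)
    (hgeom : ∀ N, ∑ i ∈ range N, (1 - γ) ^ i ≤ Q) {M : Weights H m n}
    (hM : M ∈ weightClass H m n a γ) : ‖M‖ ^ 2 ≤ m * a ^ 2 * Q := by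
  rw [EuclideanSpace.norm_sq_eq]
  simp only [Real.norm_eq_abs, sq_abs]
  simp_rw [Fintype.sum_prod_type]
  calc ∑ i : Fin H, ∑ r, ∑ s, M (i, r, s) ^ 2
      ≤ ∑ i : Fin H, (m * a ^ 2) * (1 - γ) ^ (i : ℕ) := by
        gcongr with i
        have h1 := hM (i + 1) (by simp)
        rw [Nat.add_sub_cancel] at h1
        calc ∑ r, ∑ s, M (i, r, s) ^ 2 ≤ ∑ _r : Fin m, (a * (1 - γ) ^ (i : ℕ)) ^ 2 := by
              gcongr with r
              have h2 := sum_row_sq_le (blk M (i + 1)) r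
              simp only [blk_succ M i.2] at h2
              exact h2.trans (pow_le_pow_left₀ (opNorm_nonneg _) h1 2)
          _ = (m * a ^ 2) * ((1 - γ) ^ (i : ℕ)) ^ 2 := by simp; ring
          -- One of the two factors `(1 - γ) ^ i` is dropped, so that the series already bounded by
          -- `Q` can be reused.
          _ ≤ (m * a ^ 2) * (1 - γ) ^ (i : ℕ) := by
              gcongr
              have := pow_le_one₀ (n := (i : ℕ)) hγ hγ1
              have := pow_nonneg hγ (i : ℕ)
              nlinarith
    _ = (m * a ^ 2) * ∑ i ∈ range H, (1 - γ) ^ i := by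
        rw [← mul_sum, Finset.sum_range]
    _ ≤ _ := by gcongr; exact hgeom H

/-- The disturbance-action term `∑ M^{[j]} v_j`. -/
noncomputable def dac (M : Weights H m n) (v : ℕ → Vec n) : Vec m :=
  ∑ j ∈ range H, act (blk M (j + 1)) (v (j + 1))

lemma dac_add (M N : Weights H m n) (v : ℕ → Vec n) : dac (M + N) v = dac M v + dac N v := by
  simp [dac, blk_add, add_act, sum_add_distrib]

lemma dac_smul (s : ℝ) (M : Weights H m n) (v : ℕ → Vec n) : dac (s • M) v = s • dac M v := by
  simp [dac, blk_smul, smul_act, smul_sum]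

lemma dac_sub (M N : Weights H m n) (v : ℕ → Vec n) : dac (M - N) v = dac M v - dac N v := by
  simp [dac, blk_sub, sub_act, sum_sub_distrib]

/-- This bound is for differences of weights, which are controlled only in Frobenius norm; hence the
factor `H`. For members of `weightClass` the decay of the blocks removes it, as in the next lemma.
-/
lemma norm_dac_le (M : Weights H m n) {v : ℕ → Vec n} {b : ℝ} (hv : ∀ k, ‖v k‖ ≤ b) :
    ‖dac M v‖ ≤ H * b * ‖M‖ := by
  calc ‖dac M v‖ ≤ ∑ _j ∈ range H, ‖M‖ * b :=
        norm_sum_le_of_le _ fun j _ => (norm_act_blk_le M _ _).trans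
          (mul_le_mul_of_nonneg_left (hv _) (norm_nonneg _))
    _ = H * b * ‖M‖ := by simp; ring

lemma norm_dac_le_of_mem_weightClass {a γ Q b : ℝ} (ha : 0 ≤ a) (hγ : 0 ≤ 1 - γ)
    (hgeom : ∀ N, ∑ i ∈ range N, (1 - γ) ^ i ≤ Q) {M : Weights H m n}
    (hM : M ∈ weightClass H m n a γ) {v : ℕ → Vec n} (hv : ∀ k, ‖v k‖ ≤ b) :
    ‖dac M v‖ ≤ a * b * Q := by
  have hb : 0 ≤ b := (norm_nonneg _).trans (hv 0)
  refine norm_sum_geom_le (by positivity) hgeom H _ fun i hi => ?_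
  have h1 := hM (i + 1) (by simp; omega)
  rw [Nat.add_sub_cancel] at h1
  calc _ ≤ (a * (1 - γ) ^ i) * ‖v (i + 1)‖ := norm_act_le_of_le h1 _
    _ ≤ (a * (1 - γ) ^ i) * b := by gcongr; exact hv _
    _ = _ := by ring

end Blocks

/-! ### The surrogate state and input as an `H`-step closed loop -/

section Surrogate

variable {H m n : ℕ} (A : Matrix (Fin n) (Fin n) ℝ) (B : Matrix (Fin n) (Fin m) ℝ)
  (K : Matrix (Fin m) (Fin n) ℝ)

/-- Grouping the convolution by the power of `A - B * K` exhibits the surrogate as the state reached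
from zero in `H` closed-loop steps under the constant weight. In this form it can be compared with
unrolled trajectories. -/
lemma surrState_eq (M : Weights H m n) (v : ℕ → Vec n) :
    surrState A B K M v = ∑ i ∈ range H, act ((A - B * K) ^ i)
      (act B (dac M fun j => v (i + 1 + j)) + v (i + 1)) := by
  unfold surrState psiX
  simp only [add_act, sum_act, sum_add_distrib, act_add]
  rw [add_comm]
  congr 1
  · rw [sum_comm, sum_Icc_one_eq_sum_range]
    refine sum_congr rfl fun i hi => ?_
    have hi := mem_range.1 hi
    have : ∀ k, act (if i + 1 + 1 ≤ k ∧ k ≤ i + 1 + H then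
        (A - B * K) ^ (i + 1 - 1) * B * blk M (k - (i + 1)) else 0) (v k) =
        if k ∈ Icc (i + 1 + 1) (i + 1 + H) then
          act ((A - B * K) ^ i) (act B (act (blk M (k - (i + 1))) (v k))) else 0 := by
      intro k
      simp only [mem_Icc]
      split_ifs <;> simp [mul_act]
    simp only [this]
    rw [← sum_filter, dac, act_sum, act_sum]
    -- The cut-off at `2 * H` removes nothing: both `i + 1` and `j + 1` are at most `H`.
    have hf : (Icc 1 (2 * H)).filter (fun k => k ∈ Icc (i + 1 + 1) (i + 1 + H)) =
        (range H).image (fun j => i + 1 + (j + 1)) := by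
      ext k
      simp only [mem_filter, mem_Icc, mem_image, mem_range]
      constructor
      · rintro ⟨_, h1, h2⟩
        exact ⟨k - (i + 1) - 1, by omega, by omega⟩
      · rintro ⟨j, hj, rfl⟩
        omega
    rw [hf, sum_image (fun x _ y _ h => by simpa using h)]
    refine sum_congr rfl fun j _ => ?_
    rw [Nat.add_sub_cancel_left]
  · have : ∀ k, act (if k ≤ H then (A - B * K) ^ (k - 1) else 0) (v k) =
        if k ≤ H then act ((A - B * K) ^ (k - 1)) (v k) else 0 := by
      intro k
      split_ifs <;> simp
    simp only [this]
    rw [← sum_filter]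
    have hf : (Icc 1 (2 * H)).filter (fun k => k ≤ H) = Icc 1 H := by
      ext k; simp only [mem_filter, mem_Icc]; omega
    rw [hf, sum_Icc_one_eq_sum_range]
    simp

lemma surrInput_eq (M : Weights H m n) (v : ℕ → Vec n) :
    surrInput A B K M v = dac M v - act K (surrState A B K M v) := by
  unfold surrInput psiU surrState
  simp only [sub_act, sum_sub_distrib, mul_act, act_sum]
  congr 1
  have : ∀ k, act (if k ≤ H then blk M k else 0) (v k) =
      if k ≤ H then act (blk M k) (v k) else 0 := by
    intro k
    split_ifs <;> simp
  simp only [this]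
  rw [← sum_filter]
  have hf : (Icc 1 (2 * H)).filter (fun k => k ≤ H) = Icc 1 H := by
    ext k; simp only [mem_filter, mem_Icc]; omega
  rw [hf, sum_Icc_one_eq_sum_range, dac]

lemma surrState_congr (M : Weights H m n) {v v' : ℕ → Vec n}
    (h : ∀ k, 1 ≤ k → k ≤ 2 * H → v k = v' k) :
    surrState A B K M v = surrState A B K M v' :=
  sum_congr rfl fun k hk => by rw [mem_Icc] at hk; rw [h k hk.1 hk.2]

lemma surrInput_congr (M : Weights H m n) {v v' : ℕ → Vec n}
    (h : ∀ k, 1 ≤ k → k ≤ 2 * H → v k = v' k) :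
    surrInput A B K M v = surrInput A B K M v' :=
  sum_congr rfl fun k hk => by rw [mem_Icc] at hk; rw [h k hk.1 hk.2]

/-- Response of the state of the surrogate to its weight. -/
noncomputable def surrLin (N : Weights H m n) (v : ℕ → Vec n) : Vec n :=
  ∑ i ∈ range H, act ((A - B * K) ^ i) (act B (dac N fun j => v (i + 1 + j)))

lemma surrState_sub (M N : Weights H m n) (v : ℕ → Vec n) :
    surrState A B K M v - surrState A B K N v = surrLin A B K (M - N) v := by
  simp only [surrState_eq, surrLin, ← sum_sub_distrib, dac_sub, act_sub, act_add]
  exact sum_congr rfl fun i _ => by abel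

lemma surrLin_add (M N : Weights H m n) (v : ℕ → Vec n) :
    surrLin A B K (M + N) v = surrLin A B K M v + surrLin A B K N v := by
  simp [surrLin, dac_add, act_add, sum_add_distrib]

lemma act_smul {p q : ℕ} (M : Matrix (Fin p) (Fin q) ℝ) (s : ℝ) (x : Vec q) :
    act M (s • x) = s • act M x := map_smul _ _ _

lemma surrLin_smul (s : ℝ) (M : Weights H m n) (v : ℕ → Vec n) :
    surrLin A B K (s • M) v = s • surrLin A B K M v := by
  simp [surrLin, dac_smul, act_smul, smul_sum]

end Surrogate

/-! ### Strong stability and closed-loop estimates -/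

section Gains

variable {H m n : ℕ}

/-- The inner factors `S⁻¹ * S` cancel in a power, so the conjugation costs `κ ^ 2` once, whatever
the exponent. -/
lemma StronglyStable.norm_act_pow_le {A : Matrix (Fin n) (Fin n) ℝ} {B : Matrix (Fin n) (Fin m) ℝ}
    {K : Matrix (Fin m) (Fin n) ℝ} {κ γ : ℝ} (h : StronglyStable A B κ γ K) (k : ℕ) (x : Vec n) :
    ‖act ((A - B * K) ^ k) x‖ ≤ κ ^ 2 * (1 - γ) ^ k * ‖x‖ := by
  obtain ⟨L, S, hS, hF, hL, -, hS1, hS2⟩ := h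
  have hdet : IsUnit S.det := (Matrix.isUnit_iff_isUnit_det S).1 hS
  have hpow : (A - B * K) ^ k = S * L ^ k * S⁻¹ := by
    rw [hF]
    induction k with
    | zero => simp [Matrix.mul_nonsing_inv S hdet]
    | succ k ih =>
      rw [pow_succ, ih, pow_succ]
      simp only [Matrix.mul_assoc]
      rw [← Matrix.mul_assoc S⁻¹ S, Matrix.nonsing_inv_mul S hdet, Matrix.one_mul]
  have hκ : 0 ≤ κ := (opNorm_nonneg S).trans hS1
  have hγ : 0 ≤ 1 - γ := (opNorm_nonneg L).trans hL
  rw [hpow, mul_act, mul_act]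
  calc _ ≤ κ * ((1 - γ) ^ k * (κ * ‖x‖)) := by
        refine (norm_act_le_of_le hS1 _).trans (mul_le_mul_of_nonneg_left ?_ hκ)
        refine (OGDBZC.norm_act_pow_le hL k _).trans (mul_le_mul_of_nonneg_left ?_ (by positivity))
        exact norm_act_le_of_le hS2 _
    _ = _ := by ring

/-- The bounds on a feedback gain `K` that enter all estimates: powers of `A - BK` decay like
`Q ^ 2 * ρ ^ k`, the geometric series in `ρ` is at most `Q`, and so are `‖B‖` and `‖K‖`. -/
structure GainBound (A : Matrix (Fin n) (Fin n) ℝ) (B : Matrix (Fin n) (Fin m) ℝ)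
    (K : Matrix (Fin m) (Fin n) ℝ) (ρ Q : ℝ) : Prop where
  one_le : 1 ≤ Q
  nonneg : 0 ≤ ρ
  geom : ∀ N, ∑ i ∈ range N, ρ ^ i ≤ Q
  pow : ∀ k x, ‖act ((A - B * K) ^ k) x‖ ≤ Q ^ 2 * ρ ^ k * ‖x‖
  actB : ∀ x, ‖act B x‖ ≤ Q * ‖x‖
  actK : ∀ x, ‖act K x‖ ≤ Q * ‖x‖

lemma StronglyStable.gainBound {A : Matrix (Fin n) (Fin n) ℝ} {B : Matrix (Fin n) (Fin m) ℝ}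
    {K : Matrix (Fin m) (Fin n) ℝ} {κ γ Q : ℝ} (h : StronglyStable A B κ γ K) (hQ : 1 ≤ Q)
    (hγ : 0 < γ) (hγ1 : γ ≤ 1) (hκ : 1 < κ) (hκQ : κ ≤ Q) (hγQ : γ⁻¹ ≤ Q) (hBQ : kappaB B ≤ Q) :
    GainBound A B K (1 - γ) Q where
  one_le := hQ
  nonneg := by linarith
  geom N := (sum_pow_one_sub_le hγ hγ1 N).trans hγQ
  pow k x := (h.norm_act_pow_le k x).trans (by
    have : 0 ≤ (1 - γ) ^ k := pow_nonneg (by linarith) k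
    gcongr)
  actB := norm_act_le_of_le ((le_max_left _ _).trans hBQ)
  actK := by
    obtain ⟨_, _, _, _, _, hK, _⟩ := h
    exact norm_act_le_of_le (hK.trans hκQ)

/-- Unrolling of a linear recursion started at `0`; the sum may be padded by zeros. -/
lemma eq_sum_of_recursion {F : Matrix (Fin n) (Fin n) ℝ} {x z : ℕ → Vec n} (h0 : x 0 = 0)
    (hx : ∀ t, x (t + 1) = act F (x t) + z t) (t N : ℕ) :
    x t = ∑ i ∈ range (N + t), act (F ^ i) (past z t (i + 1)) := by
  induction t with
  | zero => rw [h0]; exact (sum_eq_zero fun i _ => by simp [past]).symm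
  | succ t ih =>
    rw [← add_assoc, sum_range_succ', hx, ih, act_sum]
    congr 1
    · refine sum_congr rfl fun i _ => ?_
      rw [past_succ, pow_succ', mul_act]
    · simp [past]

variable {A : Matrix (Fin n) (Fin n) ℝ} {B : Matrix (Fin n) (Fin m) ℝ}
  {K : Matrix (Fin m) (Fin n) ℝ} {ρ Q : ℝ}

namespace GainBound

lemma Q_nonneg (h : GainBound A B K ρ Q) : 0 ≤ Q := zero_le_one.trans h.one_le

lemma norm_sum_le (h : GainBound A B K ρ Q) {C : ℝ} (hC : 0 ≤ C) (N j : ℕ) {z : ℕ → Vec n}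
    (hz : ∀ i < N, ‖z i‖ ≤ C) :
    ‖∑ i ∈ range N, act ((A - B * K) ^ (j + i)) (z i)‖ ≤ Q ^ 3 * ρ ^ j * C := by
  have hρ := h.nonneg
  have hQ := h.Q_nonneg
  calc _ ≤ (Q ^ 2 * ρ ^ j * C) * Q := by
        refine norm_sum_geom_le (by positivity) h.geom N _ fun i hi => ?_
        calc _ ≤ Q ^ 2 * ρ ^ (j + i) * ‖z i‖ := h.pow _ _
          _ ≤ Q ^ 2 * ρ ^ (j + i) * C := by gcongr; exact hz i hi
          _ = _ := by ring
    _ = _ := by ring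

lemma norm_sum_le' (h : GainBound A B K ρ Q) {C : ℝ} (hC : 0 ≤ C) (N : ℕ) {z : ℕ → Vec n}
    (hz : ∀ i < N, ‖z i‖ ≤ C) :
    ‖∑ i ∈ range N, act ((A - B * K) ^ i) (z i)‖ ≤ Q ^ 3 * C := by
  simpa using h.norm_sum_le hC N 0 hz

lemma norm_recursion_le (h : GainBound A B K ρ Q) {C : ℝ} {x z : ℕ → Vec n} (h0 : x 0 = 0)
    (hx : ∀ t, x (t + 1) = act (A - B * K) (x t) + z t) (hz : ∀ t, ‖z t‖ ≤ C) (t : ℕ) :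
    ‖x t‖ ≤ Q ^ 3 * C := by
  rw [eq_sum_of_recursion h0 hx t 0]
  exact h.norm_sum_le' ((norm_nonneg _).trans (hz 0)) _ fun i _ => norm_past_le hz t (i + 1)

lemma norm_actB_add_le (h : GainBound A B K ρ Q) {C b : ℝ} {g : Vec m} {w : Vec n}
    (hg : ‖g‖ ≤ C) (hw : ‖w‖ ≤ b) : ‖act B g + w‖ ≤ Q * C + b :=
  (norm_add_le _ _).trans (add_le_add ((h.actB g).trans
    (mul_le_mul_of_nonneg_left hg h.Q_nonneg)) hw)

lemma norm_surrState_le (h : GainBound A B K ρ Q) {C b : ℝ} {M : Weights H m n} {v : ℕ → Vec n}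
    (hv : ∀ k, ‖v k‖ ≤ b) (hM : ∀ v : ℕ → Vec n, (∀ k, ‖v k‖ ≤ b) → ‖dac M v‖ ≤ C) :
    ‖surrState A B K M v‖ ≤ Q ^ 3 * (Q * C + b) := by
  have hb := (norm_nonneg _).trans (hv 0)
  have hC := (norm_nonneg _).trans (hM v hv)
  have hQ := h.Q_nonneg
  rw [surrState_eq]
  exact h.norm_sum_le' (by positivity) _ fun i _ => h.norm_actB_add_le (hM _ fun k => hv _) (hv _)

lemma norm_surrInput_le (h : GainBound A B K ρ Q) {C b : ℝ} {M : Weights H m n} {v : ℕ → Vec n}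
    (hv : ∀ k, ‖v k‖ ≤ b) (hM : ∀ v : ℕ → Vec n, (∀ k, ‖v k‖ ≤ b) → ‖dac M v‖ ≤ C) :
    ‖surrInput A B K M v‖ ≤ C + Q ^ 4 * (Q * C + b) := by
  rw [surrInput_eq]
  refine (norm_sub_le _ _).trans (add_le_add (hM v hv) ((h.actK _).trans ?_))
  calc _ ≤ Q * (Q ^ 3 * (Q * C + b)) :=
        mul_le_mul_of_nonneg_left (h.norm_surrState_le hv hM) h.Q_nonneg
    _ = _ := by ring

lemma norm_surrLin_le (h : GainBound A B K ρ Q) {b : ℝ} (N : Weights H m n) {v : ℕ → Vec n}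
    (hv : ∀ k, ‖v k‖ ≤ b) : ‖surrLin A B K N v‖ ≤ Q ^ 4 * H * b * ‖N‖ := by
  have hb := (norm_nonneg _).trans (hv 0)
  have hQ := h.Q_nonneg
  calc _ ≤ Q ^ 3 * (Q * (H * b * ‖N‖)) := by
        refine h.norm_sum_le' (by positivity) _ fun i _ => (h.actB _).trans ?_
        gcongr
        exact norm_dac_le N fun k => hv _
    _ = _ := by ring

/-- A closed loop driven by inputs `g` stays near the surrogate state of a constant weight `M`
if over the last `H` steps `g` has been near the disturbance-action input of `M`. -/
lemma norm_sub_surrState_le (h : GainBound A B K ρ Q) {C b δ : ℝ} {x w : ℕ → Vec n}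
    {g : ℕ → Vec m} (h0 : x 0 = 0)
    (hx : ∀ t, x (t + 1) = act (A - B * K) (x t) + (act B (g t) + w t))
    (hg : ∀ t, ‖g t‖ ≤ C) (hw : ∀ t, ‖w t‖ ≤ b) (hδ : 0 ≤ δ) (M : Weights H m n) (t : ℕ)
    (hM : ∀ s < t, t ≤ s + H → ‖g s - dac M (past w s)‖ ≤ δ) :
    ‖x t - surrState A B K M (past w t)‖ ≤ Q ^ 4 * δ + Q ^ 3 * ρ ^ H * (Q * C + b) := by
  have hQ := h.Q_nonneg
  have hb := (norm_nonneg _).trans (hw 0)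
  have hC := (norm_nonneg _).trans (hg 0)
  -- Padding to `H + t` terms splits off exactly the `H` terms of the surrogate, even when `t < H`;
  -- the remaining tail carries `ρ ^ H`.
  rw [eq_sum_of_recursion h0 hx t H, sum_range_add, surrState_eq, add_sub_right_comm,
    ← sum_sub_distrib]
  refine (norm_add_le _ _).trans (add_le_add ?_ ?_)
  · simp only [← act_sub]
    calc _ ≤ Q ^ 3 * (Q * δ) := by
          refine h.norm_sum_le' (by positivity) _ fun i hi => ?_
          -- Delays reaching before time zero contribute nothing to either sum.
          rcases lt_or_ge t (i + 1) with hit | hit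
          · have h1 : dac M (fun j => past w t (i + 1 + j)) = 0 :=
              sum_eq_zero fun j _ => by
                beta_reduce; rw [past_of_lt w (by omega), act_zero]
            rw [past_of_lt _ hit, past_of_lt _ hit, h1]
            simpa using by positivity
          · have h1 : (fun j => past w t (i + 1 + j)) = past w (t - (i + 1)) :=
              funext fun j => past_add w hit j
            rw [past_of_le _ hit, past_of_le _ hit, h1, add_sub_add_right_eq_sub, ← act_sub]
            exact (h.actB _).trans (mul_le_mul_of_nonneg_left (hM _ (by omega) (by omega)) hQ)
      _ = _ := by ring
  · exact h.norm_sum_le (by positivity) _ _ fun i _ =>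
      norm_past_le (fun s => h.norm_actB_add_le (hg s) (hw s)) _ _

end GainBound

end Gains

/-! ### Imitating a linear policy by disturbance-action weights -/

section Imitation

variable {H m n : ℕ}

/-- The weights `M^{[i]} = (K - K')(A - BK')^{i-1}` by which disturbance-action control around
`K` imitates the linear policy `K'`. -/
noncomputable def imitation (H : ℕ) (A : Matrix (Fin n) (Fin n) ℝ) (B : Matrix (Fin n) (Fin m) ℝ)
    (K K' : Matrix (Fin m) (Fin n) ℝ) : Weights H m n :=
  WithLp.toLp 2 fun p => ((K - K') * (A - B * K') ^ (p.1 : ℕ)) p.2.1 p.2.2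

variable {A : Matrix (Fin n) (Fin n) ℝ} {B : Matrix (Fin n) (Fin m) ℝ}
  {K K' : Matrix (Fin m) (Fin n) ℝ} {ρ Q b : ℝ} {w : ℕ → Vec n}

lemma blk_imitation {i : ℕ} (hi : i < H) :
    blk (imitation H A B K K') (i + 1) = (K - K') * (A - B * K') ^ i := by
  ext r s
  rw [blk_succ _ hi]
  rfl

/-- The threshold `2 * κ ^ 3` is `2 * κ` for the difference of the gains times `κ ^ 2` from strong
stability of `K'`. -/
lemma imitation_mem_weightClass {κ γ a : ℝ} (hK : StronglyStable A B κ γ K)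
    (hK' : StronglyStable A B κ γ K') (ha : 2 * κ ^ 3 ≤ a) :
    imitation H A B K K' ∈ weightClass H m n a γ := by
  intro i hi
  obtain ⟨i, rfl⟩ : ∃ j, i = j + 1 := ⟨i - 1, by simp at hi; omega⟩
  rw [blk_imitation (by simp at hi; omega), Nat.add_sub_cancel]
  have h1 : opNorm K ≤ κ := by obtain ⟨_, _, _, _, _, h, _⟩ := hK; exact h
  have h2 : opNorm K' ≤ κ := by obtain ⟨_, _, _, _, _, h, _⟩ := hK'; exact h
  have hγ : 0 ≤ 1 - γ := by
    obtain ⟨L, _, _, _, h, _⟩ := hK; exact (opNorm_nonneg L).trans h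
  have hκ := (opNorm_nonneg K).trans h1
  have ha0 : 0 ≤ a := le_trans (by positivity) ha
  refine opNorm_le_of_forall (by positivity) fun x => ?_
  rw [mul_act, sub_act]
  set y := act ((A - B * K') ^ i) x
  calc ‖act K y - act K' y‖ ≤ κ * ‖y‖ + κ * ‖y‖ := (norm_sub_le _ _).trans
        (add_le_add (norm_act_le_of_le h1 _) (norm_act_le_of_le h2 _))
    _ = 2 * κ * ‖y‖ := by ring
    _ ≤ 2 * κ * (κ ^ 2 * (1 - γ) ^ i * ‖x‖) := by gcongr; exact hK'.norm_act_pow_le i x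
    _ = 2 * κ ^ 3 * (1 - γ) ^ i * ‖x‖ := by ring
    _ ≤ _ := by gcongr

/-- Puts the trajectory in the form required by `eq_sum_of_recursion` and
`GainBound.norm_recursion_le`. -/
lemma state_linPolicy_succ (w : ℕ → Vec n) (t : ℕ) :
    state A B w (linPolicy K') (t + 1) =
      act (A - B * K') (state A B w (linPolicy K') t) + w t := by
  simp only [state, linPolicy, sub_act, mul_act, act_neg]
  abel

lemma GainBound.norm_state_linPolicy_le (h' : GainBound A B K' ρ Q) (hw : ∀ t, ‖w t‖ ≤ b) (t : ℕ) :
    ‖state A B w (linPolicy K') t‖ ≤ Q ^ 3 * b :=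
  h'.norm_recursion_le rfl (state_linPolicy_succ w) hw t

lemma GainBound.norm_input_linPolicy_le (h' : GainBound A B K' ρ Q) (hw : ∀ t, ‖w t‖ ≤ b) (t : ℕ) :
    ‖input A B w (linPolicy K') t‖ ≤ Q ^ 4 * b := by
  unfold input linPolicy
  rw [norm_neg]
  calc _ ≤ Q * (Q ^ 3 * b) := (h'.actK _).trans
        (mul_le_mul_of_nonneg_left (h'.norm_state_linPolicy_le hw t) h'.Q_nonneg)
    _ = _ := by ring

/-- The input of the imitating weights differs from the imitated one only by the disturbances
older than the memory. -/
lemma norm_sub_dac_imitation_le (h : GainBound A B K ρ Q) (h' : GainBound A B K' ρ Q)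
    (hw : ∀ t, ‖w t‖ ≤ b) (t : ℕ) :
    ‖act (K - K') (state A B w (linPolicy K') t) - dac (imitation H A B K K') (past w t)‖
      ≤ 2 * Q ^ 4 * ρ ^ H * b := by
  have hb := (norm_nonneg _).trans (hw 0)
  have hQ := h.Q_nonneg
  have e : dac (imitation H A B K K') (past w t) =
      act (K - K') (∑ i ∈ range H, act ((A - B * K') ^ i) (past w t (i + 1))) := by
    rw [dac, act_sum]
    exact sum_congr rfl fun i hi => by rw [blk_imitation (mem_range.1 hi), mul_act]
  rw [e, ← act_sub, eq_sum_of_recursion rfl (state_linPolicy_succ w) t H, sum_range_add,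
    add_sub_cancel_left, sub_act]
  set y := ∑ i ∈ range t, act ((A - B * K') ^ (H + i)) (past w t (H + i + 1))
  have hy : ‖y‖ ≤ Q ^ 3 * ρ ^ H * b := h'.norm_sum_le hb _ _ fun i _ => norm_past_le hw _ _
  calc ‖act K y - act K' y‖ ≤ Q * ‖y‖ + Q * ‖y‖ :=
        (norm_sub_le _ _).trans (add_le_add (h.actK _) (h'.actK _))
    _ = 2 * Q * ‖y‖ := by ring
    _ ≤ 2 * Q * (Q ^ 3 * ρ ^ H * b) := by gcongr
    _ = _ := by ring

/-- The policy `K'` is the closed loop of `K` driven by the extra input (K - K')x, and the imitating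
weights match that input up to order `ρ ^ H`. So `GainBound.norm_sub_surrState_le` applies. -/
lemma norm_state_linPolicy_sub_surrState_le (h : GainBound A B K ρ Q) (h' : GainBound A B K' ρ Q)
    (hw : ∀ t, ‖w t‖ ≤ b) (t : ℕ) :
    ‖state A B w (linPolicy K') t - surrState A B K (imitation H A B K K') (past w t)‖
      ≤ 5 * Q ^ 8 * ρ ^ H * b := by
  have hb := (norm_nonneg _).trans (hw 0)
  have hQ := h.Q_nonneg
  have hρ := h.nonneg
  have hx : ∀ t, state A B w (linPolicy K') (t + 1) =
      act (A - B * K) (state A B w (linPolicy K') t) +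
        (act B (act (K - K') (state A B w (linPolicy K') t)) + w t) := by
    intro t
    rw [state_linPolicy_succ]
    simp only [sub_act, mul_act, act_sub]
    abel
  have hg : ∀ t, ‖act (K - K') (state A B w (linPolicy K') t)‖ ≤ 2 * Q ^ 4 * b := by
    intro t
    have := h'.norm_state_linPolicy_le hw t
    rw [sub_act]
    set y := state A B w (linPolicy K') t
    calc ‖act K y - act K' y‖ ≤ Q * ‖y‖ + Q * ‖y‖ :=
          (norm_sub_le _ _).trans (add_le_add (h.actK _) (h'.actK _))
      _ ≤ Q * (Q ^ 3 * b) + Q * (Q ^ 3 * b) := by gcongr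
      _ = _ := by ring
  refine (h.norm_sub_surrState_le rfl hx hg hw (by positivity) _ t
    fun s _ _ => norm_sub_dac_imitation_le h h' hw s).trans ?_
  have h1 : 1 ≤ Q ^ 5 := one_le_pow₀ h.one_le
  have h2 : 0 ≤ ρ ^ H * b * Q ^ 3 := by positivity
  nlinarith

lemma norm_input_linPolicy_sub_surrInput_le (h : GainBound A B K ρ Q) (h' : GainBound A B K' ρ Q)
    (hw : ∀ t, ‖w t‖ ≤ b) (t : ℕ) :
    ‖input A B w (linPolicy K') t - surrInput A B K (imitation H A B K K') (past w t)‖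
      ≤ 7 * Q ^ 9 * ρ ^ H * b := by
  have hb := (norm_nonneg _).trans (hw 0)
  have hQ := h.Q_nonneg
  have hρ := h.nonneg
  have h1 := norm_sub_dac_imitation_le (H := H) h h' hw t
  have h2 := norm_state_linPolicy_sub_surrState_le (H := H) h h' hw t
  rw [surrInput_eq, input, linPolicy]
  set x := state A B w (linPolicy K') t
  set s := surrState A B K (imitation H A B K K') (past w t)
  set d := dac (imitation H A B K K') (past w t)
  have e : -act K' x - (d - act K s) = (act (K - K') x - d) - act K (x - s) := by
    rw [sub_act, act_sub]; abel
  rw [e]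
  calc _ ≤ 2 * Q ^ 4 * ρ ^ H * b + Q * (5 * Q ^ 8 * ρ ^ H * b) :=
        (norm_sub_le _ _).trans (add_le_add h1 ((h.actK _).trans (by gcongr)))
    _ ≤ _ := by
        have h1 : 1 ≤ Q ^ 5 := one_le_pow₀ h.one_le
        have h2 : 0 ≤ ρ ^ H * b * Q ^ 4 := by positivity
        nlinarith

end Imitation

/-! ### The gradient inequality for convex functions -/

section Convexity

variable {E : Type*} [NormedAddCommGroup E] [NormedSpace ℝ E]

/-- The gradient inequality. -/
lemma sub_le_fderiv_of_convexOn {f : E → ℝ} (hf : ConvexOn ℝ Set.univ f) {x : E}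
    (hd : DifferentiableAt ℝ f x) (y : E) : f x - f y ≤ fderiv ℝ f x (x - y) := by
  have hl : HasDerivAt (fun s : ℝ => AffineMap.lineMap x y s) (y - x) 0 := by
    simpa using (AffineMap.lineMap x y : ℝ →ᵃ[ℝ] E).hasDerivAt (x := 0)
  have h1 : HasDerivAt (fun s : ℝ => f (AffineMap.lineMap x y s)) (fderiv ℝ f x (y - x)) 0 := by
    refine HasFDerivAt.comp_hasDerivAt (0 : ℝ) ?_ hl
    simpa using hd.hasFDerivAt
  have h2 := (hf.comp_affineMap (AffineMap.lineMap x y : ℝ →ᵃ[ℝ] E)).le_slope_of_hasDerivAt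
    (Set.mem_univ (0 : ℝ)) (Set.mem_univ (1 : ℝ)) one_pos h1
  simp [slope] at h2
  rw [map_sub]
  linarith

end Convexity

/-! ### Metric projection and projected gradient descent -/

section Projection

variable {E : Type*} [NormedAddCommGroup E]

lemma proj_mem_and_le [ProperSpace E] {S : Set E} (hS : IsClosed S) (hne : S.Nonempty) (y : E) :
    proj S y ∈ S ∧ ∀ s ∈ S, ‖y - proj S y‖ ≤ ‖y - s‖ := by
  obtain ⟨z, hz, hzy⟩ := hS.exists_infDist_eq_dist hne y
  unfold proj
  refine Classical.epsilon_spec (p := fun z => z ∈ S ∧ ∀ s ∈ S, ‖y - z‖ ≤ ‖y - s‖)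
    ⟨z, hz, fun s hs => ?_⟩
  rw [← dist_eq_norm, ← dist_eq_norm, ← hzy]
  exact Metric.infDist_le_dist_of_mem hs

variable [InnerProductSpace ℝ E]

/-- At the nearest point `z` the vectors `y - z` and `p - z` make a non-acute angle, so expanding
`‖y - p‖ ^ 2` around `z` leaves at least `‖z - p‖ ^ 2`. -/
lemma norm_proj_sub_le [ProperSpace E] {S : Set E} (hS : IsClosed S) (hc : Convex ℝ S) (y : E)
    {p : E} (hp : p ∈ S) : ‖proj S y - p‖ ≤ ‖y - p‖ := by
  obtain ⟨hz, hmin⟩ := proj_mem_and_le hS ⟨p, hp⟩ y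
  set z := proj S y
  have : Nonempty S := ⟨⟨p, hp⟩⟩
  have hinf : ‖y - z‖ = ⨅ w : S, ‖y - w‖ :=
    le_antisymm (le_ciInf fun w => hmin w w.2)
      (ciInf_le ⟨0, by rintro _ ⟨w, rfl⟩; exact norm_nonneg _⟩ (⟨z, hz⟩ : S))
  have h1 := (norm_eq_iInf_iff_real_inner_le_zero hc hz).1 hinf p hp
  have h2 : ‖y - p‖ ^ 2 = ‖y - z‖ ^ 2 + 2 * ⟪y - z, z - p⟫ + ‖z - p‖ ^ 2 := by
    rw [← norm_add_sq_real]; congr 2; abel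
  have h3 : ⟪y - z, z - p⟫ = -⟪y - z, p - z⟫ := by rw [← inner_neg_right, neg_sub]
  refine le_of_sq_le_sq ?_ (norm_nonneg _)
  nlinarith [sq_nonneg ‖y - z‖]

/-- The regret of projected online gradient descent for linear losses. -/
lemma sum_inner_le_of_descent {η C : ℝ} (hη : 0 < η) {M g : ℕ → E} {p : E}
    (hstep : ∀ t, ‖M (t + 1) - p‖ ≤ ‖M t - η • g t - p‖) (hg : ∀ t, ‖g t‖ ≤ C) (T : ℕ) :
    ∑ t ∈ range T, ⟪g t, M t - p⟫ ≤ ‖M 0 - p‖ ^ 2 / (2 * η) + T * (η * C ^ 2 / 2) := by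
  -- The current squared distance is kept as a potential so that the induction telescopes.
  suffices h : ∑ t ∈ range T, ⟪g t, M t - p⟫ + ‖M T - p‖ ^ 2 / (2 * η) ≤
      ‖M 0 - p‖ ^ 2 / (2 * η) + T * (η * C ^ 2 / 2) by
    have : 0 ≤ ‖M T - p‖ ^ 2 / (2 * η) := by positivity
    linarith
  induction T with
  | zero => simp
  | succ T ih =>
    rw [sum_range_succ]
    have h1 : ‖M (T + 1) - p‖ ^ 2 ≤
        ‖M T - p‖ ^ 2 - 2 * η * ⟪g T, M T - p⟫ + η ^ 2 * C ^ 2 := by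
      calc _ ≤ ‖M T - η • g T - p‖ ^ 2 := by gcongr; exact hstep T
        _ = ‖(M T - p) - η • g T‖ ^ 2 := by congr 2; abel
        _ = ‖M T - p‖ ^ 2 - 2 * η * ⟪g T, M T - p⟫ + η ^ 2 * ‖g T‖ ^ 2 := by
            rw [norm_sub_sq_real, inner_smul_right, norm_smul, real_inner_comm, mul_pow,
              Real.norm_eq_abs, sq_abs]
            ring
        _ ≤ _ := by gcongr; exact hg T
    have h2 : ‖M (T + 1) - p‖ ^ 2 / (2 * η) ≤
        ‖M T - p‖ ^ 2 / (2 * η) - ⟪g T, M T - p⟫ + η * C ^ 2 / 2 := by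
      calc _ ≤ (‖M T - p‖ ^ 2 - 2 * η * ⟪g T, M T - p⟫ + η ^ 2 * C ^ 2) / (2 * η) := by gcongr
        _ = _ := by field_simp
    push_cast
    linarith

end Projection

/-! ### Consequences of the loss assumption -/

section Loss

variable {n m : ℕ} {c : ℕ → Vec n → Vec m → ℝ} {G : ℝ}

lemma norm_gradient {E : Type*} [NormedAddCommGroup E] [InnerProductSpace ℝ E] [CompleteSpace E]
    (f : E → ℝ) (x : E) : ‖gradient f x‖ = ‖fderiv ℝ f x‖ := by
  rw [← toDual_gradient, LinearIsometryEquiv.norm_map]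

lemma LossAssumption.nonneg (hc : LossAssumption c G) : 0 ≤ G := by
  have h := ((hc 0).2.2 1 0 0 (by simp) (by simp)).1
  linarith [abs_nonneg (c 0 0 0)]

lemma LossAssumption.zero (hc : LossAssumption c G) (t : ℕ) : c t 0 0 = 0 := by
  have h := ((hc t).2.2 0 0 0 (by simp) (by simp)).1
  simpa using h

lemma LossAssumption.fderiv_le (hc : LossAssumption c G) (t : ℕ) {D : ℝ} {x : Vec n} {u : Vec m}
    (hx : ‖x‖ ≤ D) (hu : ‖u‖ ≤ D) (d : Vec n × Vec m) :
    |fderiv ℝ (fun p : Vec n × Vec m => c t p.1 p.2) (x, u) d| ≤ G * D * (‖d.1‖ + ‖d.2‖) := by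
  obtain ⟨-, hd, hb⟩ := hc t
  obtain ⟨-, h1, h2⟩ := hb D x u hx hu
  have hφ := (hd (x, u)).hasFDerivAt
  set L := fderiv ℝ (fun p : Vec n × Vec m => c t p.1 p.2) (x, u)
  have e1 : fderiv ℝ (fun x' => c t x' u) x = L.comp (.inl ℝ (Vec n) (Vec m)) :=
    (HasFDerivAt.comp (g := fun p : Vec n × Vec m => c t p.1 p.2) (f := fun x' => (x', u)) x hφ
      (hasFDerivAt_prodMk_left x u)).fderiv
  have e2 : fderiv ℝ (fun u' => c t x u') u = L.comp (.inr ℝ (Vec n) (Vec m)) :=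
    (HasFDerivAt.comp (g := fun p : Vec n × Vec m => c t p.1 p.2) (f := fun u' => (x, u')) u hφ
      (hasFDerivAt_prodMk_right x u)).fderiv
  rw [norm_gradient, e1] at h1
  rw [norm_gradient, e2] at h2
  have e : L d = (L.comp (.inl ℝ (Vec n) (Vec m))) d.1 + (L.comp (.inr ℝ (Vec n) (Vec m))) d.2 := by
    simp only [ContinuousLinearMap.comp_apply, ContinuousLinearMap.inl_apply,
      ContinuousLinearMap.inr_apply, ← map_add]
    simp
  rw [e, mul_add]
  exact (abs_add_le _ _).trans (add_le_add (ContinuousLinearMap.le_of_opNorm_le _ h1 _)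
    (ContinuousLinearMap.le_of_opNorm_le _ h2 _))

/-- The gradient inequality at the first point gives a one-sided estimate, so only that point has to
lie within radius `D`. -/
lemma LossAssumption.sub_le (hc : LossAssumption c G) (t : ℕ) {D : ℝ} {x : Vec n} {u : Vec m}
    (hx : ‖x‖ ≤ D) (hu : ‖u‖ ≤ D) (x' : Vec n) (u' : Vec m) :
    c t x u - c t x' u' ≤ G * D * (‖x - x'‖ + ‖u - u'‖) :=
  (sub_le_fderiv_of_convexOn (hc t).1 ((hc t).2.1 (x, u)) (x', u')).trans
    ((le_abs_self _).trans (hc.fderiv_le t hx hu _))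

end Loss

/-! ### The approximate cost as a convex function of the weight -/

section Response

variable {H m n : ℕ} (A : Matrix (Fin n) (Fin n) ℝ) (B : Matrix (Fin n) (Fin m) ℝ)
  (K : Matrix (Fin m) (Fin n) ℝ)

/-- The linear part of the map from weights to the surrogate state and input. -/
noncomputable def respLin (v : ℕ → Vec n) : Weights H m n →L[ℝ] Vec n × Vec m :=
  LinearMap.toContinuousLinearMap
    { toFun := fun M => (surrLin A B K M v, dac M v - act K (surrLin A B K M v))
      map_add' := fun M N => by
        simp only [surrLin_add, dac_add, act_add, Prod.mk_add_mk]
        congr 1; abel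
      map_smul' := fun s M => by
        simp only [surrLin_smul, dac_smul, act_smul, RingHom.id_apply, Prod.smul_mk, smul_sub] }

/-- The surrogate state and input. -/
noncomputable def resp (v : ℕ → Vec n) (M : Weights H m n) : Vec n × Vec m :=
  (surrState A B K M v, surrInput A B K M v)

lemma resp_sub (v : ℕ → Vec n) (M N : Weights H m n) :
    resp A B K v M - resp A B K v N = respLin A B K v (M - N) := by
  have h : respLin A B K v (M - N) =
      (surrLin A B K (M - N) v, dac (M - N) v - act K (surrLin A B K (M - N) v)) := rfl
  rw [h, ← surrState_sub, dac_sub, act_sub, resp, resp, surrInput_eq, surrInput_eq,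
    Prod.mk_sub_mk]
  congr 1; abel

lemma resp_eq (v : ℕ → Vec n) (M : Weights H m n) :
    resp A B K v M = resp A B K v (0 : Weights H m n) + respLin A B K v M := by
  rw [← sub_eq_iff_eq_add', resp_sub, sub_zero]

/-- The response is affine in the weight. This yields both the convexity of the approximate cost and
that of the safe set. -/
lemma resp_combination (v : ℕ → Vec n) (M N : Weights H m n) {s t : ℝ} (h : s + t = 1) :
    resp A B K v (s • M + t • N) = s • resp A B K v M + t • resp A B K v N := by
  rw [resp_eq, resp_eq A B K v M, resp_eq A B K v N, map_add, map_smul, map_smul, smul_add,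
    smul_add]
  have : resp A B K v (0 : Weights H m n) =
      s • resp A B K v (0 : Weights H m n) + t • resp A B K v (0 : Weights H m n) := by
    rw [← add_smul, h, one_smul]
  conv_lhs => rw [this]
  abel

lemma continuous_resp (v : ℕ → Vec n) :
    Continuous (resp A B K v : Weights H m n → Vec n × Vec m) := by
  have : (resp A B K v : Weights H m n → Vec n × Vec m) =
      fun M => resp A B K v (0 : Weights H m n) + respLin A B K v M := funext (resp_eq A B K v)
  rw [this]
  fun_prop

lemma hasFDerivAt_resp (v : ℕ → Vec n) (M : Weights H m n) :
    HasFDerivAt (resp A B K v) (respLin A B K v) M := by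
  have : (resp A B K v : Weights H m n → Vec n × Vec m) =
      fun M => resp A B K v (0 : Weights H m n) + respLin A B K v M := funext (resp_eq A B K v)
  rw [this]
  exact (respLin A B K v).hasFDerivAt.const_add _

variable {A B K} {ρ Q b : ℝ}

lemma GainBound.norm_respLin_le (h : GainBound A B K ρ Q) (N : Weights H m n) {v : ℕ → Vec n}
    (hv : ∀ k, ‖v k‖ ≤ b) :
    ‖(respLin A B K v N).1‖ + ‖(respLin A B K v N).2‖ ≤ 3 * Q ^ 5 * H * b * ‖N‖ := by
  have hb := (norm_nonneg _).trans (hv 0)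
  have hQ := h.Q_nonneg
  have h1 := h.norm_surrLin_le N hv
  have h2 := norm_dac_le N hv
  have h3 : ‖dac N v - act K (surrLin A B K N v)‖ ≤
      H * b * ‖N‖ + Q * (Q ^ 4 * H * b * ‖N‖) :=
    (norm_sub_le _ _).trans (add_le_add h2 ((h.actK _).trans (by gcongr)))
  have e1 : 1 ≤ Q ^ 5 := one_le_pow₀ h.one_le
  have e2 : Q ^ 4 ≤ Q ^ 5 := pow_le_pow_right₀ h.one_le (by norm_num)
  have e3 : 0 ≤ H * b * ‖N‖ := by positivity
  have e4 : ‖(respLin A B K v N).1‖ + ‖(respLin A B K v N).2‖ =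
    ‖surrLin A B K N v‖ + ‖dac N v - act K (surrLin A B K N v)‖ := rfl
  rw [e4]
  nlinarith

variable {c : ℕ → Vec n → Vec m → ℝ} {G : ℝ} {w : ℕ → Vec n}

lemma approxCost_hasFDerivAt (hc : LossAssumption c G) (w : ℕ → Vec n) (t : ℕ)
    (M : Weights H m n) :
    HasFDerivAt (approxCost A B K c w t)
      ((fderiv ℝ (fun p : Vec n × Vec m => c t p.1 p.2) (resp A B K (past w t) M)).comp
        (respLin A B K (past w t))) M :=
  ((hc t).2.1 (resp A B K (past w t) M)).hasFDerivAt.comp M (hasFDerivAt_resp A B K _ M)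

lemma approxCost_convex (hc : LossAssumption c G) (w : ℕ → Vec n) (t : ℕ) :
    ConvexOn ℝ Set.univ (approxCost A B K c w t : Weights H m n → ℝ) := by
  refine ⟨convex_univ, fun M _ N _ r s hr hs hrs => ?_⟩
  have h := (hc t).1.2 (Set.mem_univ (resp A B K (past w t) M))
    (Set.mem_univ (resp A B K (past w t) N)) hr hs hrs
  rw [← resp_combination A B K _ M N hrs] at h
  exact h

/-- The gradient of the approximate cost is bounded where the surrogate is. -/
lemma norm_gradient_approxCost_le (h : GainBound A B K ρ Q) (hc : LossAssumption c G)
    (hw : ∀ t, ‖w t‖ ≤ b) (t : ℕ) {M : Weights H m n} {D : ℝ}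
    (hx : ‖surrState A B K M (past w t)‖ ≤ D) (hu : ‖surrInput A B K M (past w t)‖ ≤ D) :
    ‖gradient (approxCost A B K c w t) M‖ ≤ G * D * (3 * Q ^ 5 * H * b) := by
  have hb := (norm_nonneg _).trans (hw 0)
  have hQ := h.Q_nonneg
  have hG := hc.nonneg
  have hD := (norm_nonneg _).trans hx
  rw [norm_gradient, (approxCost_hasFDerivAt hc w t M).fderiv]
  refine ContinuousLinearMap.opNorm_le_bound _ (by positivity) fun N => ?_
  calc _ ≤ G * D * (‖(respLin A B K (past w t) N).1‖ + ‖(respLin A B K (past w t) N).2‖) :=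
        hc.fderiv_le t hx hu _
    _ ≤ G * D * (3 * Q ^ 5 * H * b * ‖N‖) := by
        gcongr; exact h.norm_respLin_le N fun k => norm_past_le hw t k
    _ = _ := by ring

lemma approxCost_sub_le_inner (hc : LossAssumption c G) (w : ℕ → Vec n) (t : ℕ)
    (M N : Weights H m n) :
    approxCost A B K c w t M - approxCost A B K c w t N ≤
      ⟪gradient (approxCost A B K c w t) M, M - N⟫ := by
  have hd := (approxCost_hasFDerivAt (A := A) (B := B) (K := K) hc w t M).differentiableAt
  have h := sub_le_fderiv_of_convexOn (approxCost_convex hc w t) hd N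
  rwa [← toDual_gradient, InnerProductSpace.toDual_apply_apply] at h

end Response

/-! ### Closedness and convexity of the safe policy set -/

section SafeSet

variable {H m n : ℕ}

/-- As an intersection of translates, the shrinkage inherits closedness and convexity; `Δ ≥ 0` makes
the zero translate available. -/
lemma shrink_eq {d : ℕ} (D : Set (Vec d)) {Δ : ℝ} (hΔ : 0 ≤ Δ) :
    shrink D Δ = ⋂ y ∈ boxBall d Δ, (fun x => x + y) ⁻¹' D := by
  ext x
  simp only [shrink, Set.mem_ofPred_eq, Set.mem_iInter, Set.mem_preimage]
  exact ⟨fun h => h.2, fun h => ⟨by simpa using h 0 (zero_mem_boxBall hΔ), h⟩⟩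

lemma isClosed_shrink {d : ℕ} {D : Set (Vec d)} (hD : IsClosed D) {Δ : ℝ} (hΔ : 0 ≤ Δ) :
    IsClosed (shrink D Δ) := by
  rw [shrink_eq D hΔ]
  exact isClosed_biInter fun y _ => hD.preimage (by fun_prop)

lemma convex_shrink {d : ℕ} {D : Set (Vec d)} (hD : Convex ℝ D) {Δ : ℝ} (hΔ : 0 ≤ Δ) :
    Convex ℝ (shrink D Δ) := by
  rw [shrink_eq D hΔ]
  exact convex_iInter₂ fun y _ => hD.translate_preimage_left y

lemma opNorm_le_iff {p q : ℕ} {M : Matrix (Fin p) (Fin q) ℝ} {C : ℝ} (hC : 0 ≤ C) :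
    opNorm M ≤ C ↔ ∀ x, ‖act M x‖ ≤ C * ‖x‖ :=
  ⟨fun h => norm_act_le_of_le h, opNorm_le_of_forall hC⟩

/-- Testing spectral norms on single vectors turns each condition into a sublevel set of the norm of
a linear map. -/
lemma weightClass_eq {a γ : ℝ} (ha : 0 ≤ a) (hγ : 0 ≤ 1 - γ) :
    weightClass H m n a γ = ⋂ i ∈ Icc 1 H, ⋂ x : Vec n,
      {M | ‖act (blk M i) x‖ ≤ a * (1 - γ) ^ (i - 1) * ‖x‖} := by
  ext M
  simp only [weightClass, Set.mem_ofPred_eq, Set.mem_iInter]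
  exact forall₂_congr fun i _ => opNorm_le_iff (by positivity)

/-- A block of the weight, applied to a vector. -/
noncomputable def blkLin (H m : ℕ) (i : ℕ) (x : Vec n) : Weights H m n →L[ℝ] Vec m :=
  LinearMap.toContinuousLinearMap
    { toFun := fun M => act (blk M i) x
      map_add' := fun M N => by rw [blk_add, add_act]
      map_smul' := fun s M => by rw [blk_smul, smul_act, RingHom.id_apply] }

lemma isClosed_weightClass {a γ : ℝ} (ha : 0 ≤ a) (hγ : 0 ≤ 1 - γ) :
    IsClosed (weightClass H m n a γ) := by
  rw [weightClass_eq ha hγ]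
  exact isClosed_biInter fun i _ => isClosed_iInter fun x =>
    isClosed_le (blkLin H m i x).continuous.norm continuous_const

lemma convex_weightClass {a γ : ℝ} (ha : 0 ≤ a) (hγ : 0 ≤ 1 - γ) :
    Convex ℝ (weightClass H m n a γ) := by
  rw [weightClass_eq ha hγ]
  refine convex_iInter₂ fun i _ => convex_iInter fun x => ?_
  have := (convexOn_univ_norm (E := Vec m)).comp_linearMap (blkLin H m i x).toLinearMap
  simpa [blkLin] using this.convex_le (a * (1 - γ) ^ (i - 1) * ‖x‖)

variable {A : Matrix (Fin n) (Fin n) ℝ} {B : Matrix (Fin n) (Fin m) ℝ}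
  {K : Matrix (Fin m) (Fin n) ℝ} {wbar a γ ε : ℝ} {X : Set (Vec n)} {U : Set (Vec m)}

lemma safeSet_eq : (safeSet A B K wbar X U a γ ε : Set (Weights H m n)) =
    weightClass H m n a γ ∩ ⋂ v : ℕ → Vec n, ⋂ _ : ∀ k, v k ∈ boxBall n wbar,
      resp A B K v ⁻¹' (shrink X ε ×ˢ shrink U ε) := by
  ext M
  simp [safeSet, resp]

lemma isClosed_safeSet (ha : 0 ≤ a) (hγ : 0 ≤ 1 - γ) (hε : 0 ≤ ε) (hX : IsClosed X)
    (hU : IsClosed U) : IsClosed (safeSet A B K wbar X U a γ ε : Set (Weights H m n)) := by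
  rw [safeSet_eq]
  exact (isClosed_weightClass ha hγ).inter <| isClosed_iInter fun v => isClosed_iInter fun _ =>
    ((isClosed_shrink hX hε).prod (isClosed_shrink hU hε)).preimage (continuous_resp A B K v)

lemma convex_safeSet (ha : 0 ≤ a) (hγ : 0 ≤ 1 - γ) (hε : 0 ≤ ε) (hX : Convex ℝ X)
    (hU : Convex ℝ U) : Convex ℝ (safeSet A B K wbar X U a γ ε : Set (Weights H m n)) := by
  rw [safeSet_eq]
  refine (convex_weightClass ha hγ).inter <| convex_iInter fun v => convex_iInter fun _ => ?_
  intro M hM N hN r s hr hs hrs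
  rw [Set.mem_preimage, resp_combination A B K v M N hrs]
  exact ((convex_shrink hX hε).prod (convex_shrink hU hε)) hM hN hr hs hrs

end SafeSet

/-! ### A comparator inside the safe policy set -/

section Comparator

/-- A convex combination with a point of a shrunken set absorbs perturbations. -/
lemma combination_mem_shrink {d : ℕ} {D : Set (Vec d)} (hD : Convex ℝ D) {ε δ e l : ℝ}
    {x s z r : Vec d} (hx : x ∈ D) (hz : z ∈ shrink D δ) (hxs : ‖x - s‖ ≤ e) (hzr : ‖z - r‖ ≤ e)
    (hl : 0 ≤ l) (hl1 : l ≤ 1) (hε : 0 ≤ ε) (hle : ε + e ≤ l * δ) :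
    (1 - l) • s + l • r ∈ shrink D ε := by
  have key : ∀ y ∈ boxBall d ε, (1 - l) • s + l • r + y ∈ D := by
    intro y hy
    -- Everything to be absorbed is collected in `y'`. Placed on the summand `l • z`, it shifts `z`
    -- by `l⁻¹ • y'`, which the margin `δ` allows.
    set y' : Vec d := y + ((1 - l) • (s - x) + l • (r - z)) with hy'
    have hy'i : ∀ i, |y' i| ≤ l * δ := by
      intro i
      have h1 : ‖(1 - l) • (s - x) + l • (r - z)‖ ≤ e := by
        rw [norm_sub_rev] at hxs hzr
        calc _ ≤ (1 - l) * ‖s - x‖ + l * ‖r - z‖ := by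
              refine (norm_add_le _ _).trans ?_
              rw [norm_smul, norm_smul, Real.norm_of_nonneg hl,
                Real.norm_of_nonneg (sub_nonneg.2 hl1)]
          _ ≤ (1 - l) * e + l * e := by
              gcongr
          _ = e := by ring
      calc |y' i| ≤ |y i| + |((1 - l) • (s - x) + l • (r - z)) i| := abs_add_le _ _
        _ ≤ ε + e := add_le_add (hy i) ((PiLp.norm_apply_le _ i).trans h1)
        _ ≤ _ := hle
    have e1 : (1 - l) • s + l • r + y = (1 - l) • x + l • z + y' := by
      rw [hy']; module
    rw [e1]
    rcases hl.eq_or_lt with h0 | h0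
    · subst h0
      have : y' = 0 := by
        ext i
        simpa using hy'i i
      rw [this]
      simpa using hx
    · have e2 : (1 - l) • x + l • z + y' = (1 - l) • x + l • (z + l⁻¹ • y') := by
        rw [smul_add, smul_inv_smul₀ h0.ne', add_assoc]
      rw [e2]
      refine hD hx (hz.2 _ fun i => ?_) (sub_nonneg.2 hl1) hl (by ring)
      have : (l⁻¹ • y') i = l⁻¹ * y' i := rfl
      rw [this, abs_mul, abs_of_pos (inv_pos.2 h0), inv_mul_le_iff₀ h0]
      exact hy'i i
  exact ⟨by simpa using key 0 (zero_mem_boxBall hε), key⟩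

variable {H m n T : ℕ} {A : Matrix (Fin n) (Fin n) ℝ} {B : Matrix (Fin n) (Fin m) ℝ}
  {K K' Kss : Matrix (Fin m) (Fin n) ℝ} {X : Set (Vec n)} {U : Set (Vec m)}
  {wbar κ γ a Q b ε εstar l : ℝ}

/-- Any window `v` of length `2 * H` is realised as the actual past at time `2 * H`. Safety of `K'`
and strict safety of `Kss` at that time transfer to the surrogates, up to truncation errors paid for
by the margin `l * εstar`. Since `K'` is safe only up to `T`, this needs `2 * H ≤ T`. -/
lemma imitation_combination_mem_safeSet (hX : Convex ℝ X) (hU : Convex ℝ U) (ha : 2 * κ ^ 3 ≤ a)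
    (ha0 : 0 ≤ a) (hbox : ∀ y ∈ boxBall n wbar, ‖y‖ ≤ b)
    (hs : StronglyStable A B κ γ K) (h : GainBound A B K (1 - γ) Q)
    (hK' : K' ∈ safeLinear A B wbar X U κ γ T) (h' : GainBound A B K' (1 - γ) Q)
    (hKss : StronglyStable A B κ γ Kss) (hss : GainBound A B Kss (1 - γ) Q)
    (hsafe : StrictlySafe A B wbar X U εstar Kss) (hT : 2 * H ≤ T) (hε : 0 ≤ ε)
    (hl : 0 ≤ l) (hl1 : l ≤ 1) (hle : ε + 7 * Q ^ 9 * (1 - γ) ^ H * b ≤ l * εstar) :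
    (1 - l) • imitation H A B K K' + l • imitation H A B K Kss ∈
      safeSet A B K wbar X U a γ ε := by
  refine ⟨convex_weightClass ha0 h.nonneg (imitation_mem_weightClass hs hK'.1 ha)
    (imitation_mem_weightClass hs hKss ha) (sub_nonneg.2 hl1) hl (by ring), fun v hv => ?_⟩
  -- Time reversal makes the disturbance of delay `k` at time `2 * H` equal to `v k`. Later times
  -- take the value `v 0`, which is also in the box.
  set w : ℕ → Vec n := fun s => v (2 * H - s) with hwdef
  have hw : w ∈ Disturbances n wbar := fun s => hv _
  have hwb : ∀ s, ‖w s‖ ≤ b := fun s => hbox _ (hv _)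
  have hb : 0 ≤ b := (norm_nonneg _).trans (hwb 0)
  have hpast : ∀ k, 1 ≤ k → k ≤ 2 * H → past w (2 * H) k = v k := by
    intro k _ hk
    rw [past_of_le w hk]
    show v (2 * H - (2 * H - k)) = v k
    congr 1
    omega
  have hstate : ∀ K'' : Matrix (Fin m) (Fin n) ℝ, GainBound A B K'' (1 - γ) Q →
      ‖state A B w (linPolicy K'') (2 * H) - surrState A B K (imitation H A B K K'') v‖ ≤
        7 * Q ^ 9 * (1 - γ) ^ H * b := by
    intro K'' h''
    rw [← surrState_congr A B K _ hpast]
    refine (norm_state_linPolicy_sub_surrState_le h h'' hwb _).trans ?_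
    have h0 := pow_nonneg h.nonneg H
    have h1 := h.Q_nonneg
    have h2 := h.one_le
    gcongr <;> norm_num
  have hinput : ∀ K'' : Matrix (Fin m) (Fin n) ℝ, GainBound A B K'' (1 - γ) Q →
      ‖input A B w (linPolicy K'') (2 * H) - surrInput A B K (imitation H A B K K'') v‖ ≤
        7 * Q ^ 9 * (1 - γ) ^ H * b := by
    intro K'' h''
    rw [← surrInput_congr A B K _ hpast]
    exact norm_input_linPolicy_sub_surrInput_le h h'' hwb _
  have hr := resp_combination A B K v (imitation H A B K K') (imitation H A B K Kss)
    (sub_add_cancel 1 l)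
  have h1 : surrState A B K ((1 - l) • imitation H A B K K' + l • imitation H A B K Kss) v =
      _ := congrArg Prod.fst hr
  have h2 : surrInput A B K ((1 - l) • imitation H A B K K' + l • imitation H A B K Kss) v =
      _ := congrArg Prod.snd hr
  rw [h1, h2]
  have hT' := hK'.2 w hw _ hT
  have hT'' := hsafe w hw (2 * H)
  exact ⟨combination_mem_shrink hX hT'.1 hT''.1 (hstate K' h') (hstate Kss hss) hl hl1 hε hle,
    combination_mem_shrink hU hT'.2 hT''.2 (hinput K' h') (hinput Kss hss) hl hl1 hε hle⟩

end Comparator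

/-! ### Disturbance-action control with varying weights -/

section DisturbanceAction

variable {H m n : ℕ} {A : Matrix (Fin n) (Fin n) ℝ} {B : Matrix (Fin n) (Fin m) ℝ}
  {K K' : Matrix (Fin m) (Fin n) ℝ} {γ a Q b G δ : ℝ} {w : ℕ → Vec n} {M : ℕ → Weights H m n}
  {c : ℕ → Vec n → Vec m → ℝ}

/-- Disturbance-action control with time-varying weights. -/
noncomputable def dacPolicy (K : Matrix (Fin m) (Fin n) ℝ) (M : ℕ → Weights H m n)
    (w : ℕ → Vec n) : ℕ → Vec n → Vec m :=
  fun t x => -act K x + dac (M t) (past w t)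

lemma state_dacPolicy_succ (t : ℕ) :
    state A B w (dacPolicy K M w) (t + 1) = act (A - B * K) (state A B w (dacPolicy K M w) t) +
      (act B (dac (M t) (past w t)) + w t) := by
  simp only [state, dacPolicy, sub_act, mul_act, act_add, act_neg]
  abel

lemma GainBound.norm_dac_le (h : GainBound A B K (1 - γ) Q) (ha : 0 ≤ a) (haQ : a ≤ Q)
    {N : Weights H m n} (hN : N ∈ weightClass H m n a γ) {v : ℕ → Vec n} (hv : ∀ k, ‖v k‖ ≤ b) :
    ‖dac N v‖ ≤ Q ^ 2 * b := by
  have hb := (norm_nonneg _).trans (hv 0)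
  have hQ := h.Q_nonneg
  calc _ ≤ a * b * Q := norm_dac_le_of_mem_weightClass ha h.nonneg h.geom hN hv
    _ ≤ Q * b * Q := by gcongr
    _ = _ := by ring

lemma state_bound_le (hQ : 1 ≤ Q) (hb : 0 ≤ b) : Q ^ 3 * (Q * (Q ^ 2 * b) + b) ≤ 2 * Q ^ 6 * b := by
  have h1 : Q ^ 3 ≤ Q ^ 6 := pow_le_pow_right₀ hQ (by norm_num)
  nlinarith

lemma input_bound_le (hQ : 1 ≤ Q) (hb : 0 ≤ b) :
    Q ^ 2 * b + Q ^ 4 * (Q * (Q ^ 2 * b) + b) ≤ 3 * Q ^ 7 * b := by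
  have h1 : Q ^ 2 ≤ Q ^ 7 := pow_le_pow_right₀ hQ (by norm_num)
  have h2 : Q ^ 4 ≤ Q ^ 7 := pow_le_pow_right₀ hQ (by norm_num)
  nlinarith

/-- The loss assumption takes one radius for state and input; `3 * Q ^ 7 * b` serves throughout. -/
lemma two_mul_pow_six_le (hQ : 1 ≤ Q) (hb : 0 ≤ b) : 2 * Q ^ 6 * b ≤ 3 * Q ^ 7 * b := by
  have : 0 ≤ Q := by linarith
  gcongr <;> norm_num

lemma GainBound.norm_surrState_le_of_mem (h : GainBound A B K (1 - γ) Q) (ha : 0 ≤ a) (haQ : a ≤ Q)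
    {N : Weights H m n} (hN : N ∈ weightClass H m n a γ) {v : ℕ → Vec n} (hv : ∀ k, ‖v k‖ ≤ b) :
    ‖surrState A B K N v‖ ≤ 3 * Q ^ 7 * b :=
  have hb := (norm_nonneg _).trans (hv 0)
  (h.norm_surrState_le hv fun _ hv => h.norm_dac_le ha haQ hN hv).trans
    ((state_bound_le h.one_le hb).trans (two_mul_pow_six_le h.one_le hb))

lemma GainBound.norm_surrInput_le_of_mem (h : GainBound A B K (1 - γ) Q) (ha : 0 ≤ a) (haQ : a ≤ Q)
    {N : Weights H m n} (hN : N ∈ weightClass H m n a γ) {v : ℕ → Vec n} (hv : ∀ k, ‖v k‖ ≤ b) :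
    ‖surrInput A B K N v‖ ≤ 3 * Q ^ 7 * b :=
  (h.norm_surrInput_le hv fun _ hv => h.norm_dac_le ha haQ hN hv).trans
    (input_bound_le h.one_le ((norm_nonneg _).trans (hv 0)))

lemma GainBound.norm_state_dacPolicy_le (h : GainBound A B K (1 - γ) Q) (ha : 0 ≤ a) (haQ : a ≤ Q)
    (hM : ∀ t, M t ∈ weightClass H m n a γ) (hw : ∀ t, ‖w t‖ ≤ b) (t : ℕ) :
    ‖state A B w (dacPolicy K M w) t‖ ≤ 2 * Q ^ 6 * b :=
  (h.norm_recursion_le rfl state_dacPolicy_succ (fun s => h.norm_actB_add_le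
    (h.norm_dac_le ha haQ (hM s) (norm_past_le hw s)) (hw s)) t).trans
    (state_bound_le h.one_le ((norm_nonneg _).trans (hw 0)))

lemma GainBound.norm_input_dacPolicy_le (h : GainBound A B K (1 - γ) Q) (ha : 0 ≤ a) (haQ : a ≤ Q)
    (hM : ∀ t, M t ∈ weightClass H m n a γ) (hw : ∀ t, ‖w t‖ ≤ b) (t : ℕ) :
    ‖input A B w (dacPolicy K M w) t‖ ≤ 3 * Q ^ 7 * b := by
  have hb := (norm_nonneg _).trans (hw 0)
  have hQ := h.Q_nonneg
  have h2 : Q ^ 2 ≤ Q ^ 7 := pow_le_pow_right₀ h.one_le (by norm_num)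
  unfold input dacPolicy
  refine (norm_add_le _ _).trans ?_
  rw [norm_neg]
  calc _ ≤ Q * (2 * Q ^ 6 * b) + Q ^ 2 * b := by
        refine add_le_add ((h.actK _).trans ?_) (h.norm_dac_le ha haQ (hM t) (norm_past_le hw t))
        gcongr
        exact h.norm_state_dacPolicy_le ha haQ hM hw t
    _ ≤ _ := by nlinarith

/-- The loss of slowly varying weights is near the approximate cost. -/
lemma cost_sub_approxCost_le (h : GainBound A B K (1 - γ) Q) (ha : 0 ≤ a) (haQ : a ≤ Q)
    (hM : ∀ t, M t ∈ weightClass H m n a γ) (hw : ∀ t, ‖w t‖ ≤ b) (hc : LossAssumption c G)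
    (t : ℕ) (hδ : ∀ s ≤ t, t ≤ s + H → ‖M s - M t‖ ≤ δ) :
    c t (state A B w (dacPolicy K M w) t) (input A B w (dacPolicy K M w) t) -
        approxCost A B K c w t (M t) ≤
      G * (3 * Q ^ 7 * b) * (2 * Q * (Q ^ 4 * (H * b * δ) + 2 * Q ^ 6 * (1 - γ) ^ H * b)) := by
  have hb := (norm_nonneg _).trans (hw 0)
  have hQ := h.Q_nonneg
  have hG := hc.nonneg
  have hρ := pow_nonneg h.nonneg H
  have hδ0 : 0 ≤ δ := (norm_nonneg _).trans (hδ t le_rfl (by omega))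
  set x := state A B w (dacPolicy K M w) t
  set s := surrState A B K (M t) (past w t) with hs
  have hx : ‖x - s‖ ≤ Q ^ 4 * (H * b * δ) + 2 * Q ^ 6 * (1 - γ) ^ H * b := by
    refine (h.norm_sub_surrState_le rfl state_dacPolicy_succ
      (fun s => h.norm_dac_le ha haQ (hM s) (norm_past_le hw s)) hw (by positivity) (M t) t
      (δ := H * b * δ) fun s hst hts => ?_).trans ?_
    · rw [← dac_sub]
      refine (OGDBZC.norm_dac_le _ (norm_past_le hw s)).trans ?_
      gcongr
      exact hδ s hst.le hts
    · have := mul_le_mul_of_nonneg_right (state_bound_le h.one_le hb) hρ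
      linarith
  -- Both inputs contain the same disturbance-action term at time `t`, so only the feedback on the
  -- state error remains.
  have hu : input A B w (dacPolicy K M w) t - surrInput A B K (M t) (past w t) =
      -act K (x - s) := by
    rw [surrInput_eq, input, dacPolicy, act_sub]
    abel
  have hu' : ‖input A B w (dacPolicy K M w) t - surrInput A B K (M t) (past w t)‖ ≤
      Q * ‖x - s‖ := by
    rw [hu, norm_neg]; exact h.actK _
  refine (hc.sub_le t ((h.norm_state_dacPolicy_le ha haQ hM hw t).trans
    (two_mul_pow_six_le h.one_le hb)) (h.norm_input_dacPolicy_le ha haQ hM hw t) _ _).trans ?_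
  gcongr
  calc _ ≤ ‖x - s‖ + Q * ‖x - s‖ := add_le_add le_rfl hu'
    _ ≤ 2 * Q * ‖x - s‖ := by nlinarith [norm_nonneg (x - s), h.one_le]
    _ ≤ _ := by gcongr

/-- The approximate cost of the imitating weights is near the loss of the imitated policy. -/
lemma approxCost_imitation_sub_le (h : GainBound A B K (1 - γ) Q) (h' : GainBound A B K' (1 - γ) Q)
    (ha : 0 ≤ a) (haQ : a ≤ Q) (hM : imitation H A B K K' ∈ weightClass H m n a γ)
    (hw : ∀ t, ‖w t‖ ≤ b) (hc : LossAssumption c G) (t : ℕ) :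
    approxCost A B K c w t (imitation H A B K K') -
        c t (state A B w (linPolicy K') t) (input A B w (linPolicy K') t) ≤
      G * (3 * Q ^ 7 * b) * (14 * Q ^ 9 * (1 - γ) ^ H * b) := by
  have hb := (norm_nonneg _).trans (hw 0)
  have hQ := h.Q_nonneg
  have hG := hc.nonneg
  have hρ := pow_nonneg h.nonneg H
  have h1 := norm_state_linPolicy_sub_surrState_le (H := H) h h' hw t
  have h2 := norm_input_linPolicy_sub_surrInput_le (H := H) h h' hw t
  rw [norm_sub_rev] at h1 h2
  refine (hc.sub_le t (h.norm_surrState_le_of_mem ha haQ hM (norm_past_le hw t))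
    (h.norm_surrInput_le_of_mem ha haQ hM (norm_past_le hw t)) _ _).trans ?_
  gcongr
  refine (add_le_add h1 h2).trans ?_
  have h3 : Q ^ 8 ≤ Q ^ 9 := pow_le_pow_right₀ h.one_le (by norm_num)
  have h4 : 0 ≤ (1 - γ) ^ H * b := by positivity
  nlinarith [mul_le_mul_of_nonneg_right h3 h4, pow_nonneg hQ 9]

lemma abs_approxCost_le (h : GainBound A B K (1 - γ) Q) (ha : 0 ≤ a) (haQ : a ≤ Q)
    (hw : ∀ t, ‖w t‖ ≤ b) (hc : LossAssumption c G) (t : ℕ) {N : Weights H m n}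
    (hN : N ∈ weightClass H m n a γ) :
    |approxCost A B K c w t N| ≤ G * (3 * Q ^ 7 * b) :=
  ((hc t).2.2 _ _ _ (h.norm_surrState_le_of_mem ha haQ hN (norm_past_le hw t))
    (h.norm_surrInput_le_of_mem ha haQ hN (norm_past_le hw t))).1

/-- Mixing a comparator with a second weight costs at most the mixing proportion. -/
lemma approxCost_combination_sub_le (h : GainBound A B K (1 - γ) Q) (ha : 0 ≤ a) (haQ : a ≤ Q)
    (hw : ∀ t, ‖w t‖ ≤ b) (hc : LossAssumption c G) (t : ℕ) {N N' : Weights H m n} {l : ℝ}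
    (hN : N ∈ weightClass H m n a γ) (hN' : N' ∈ weightClass H m n a γ) (hl : 0 ≤ l)
    (hl1 : l ≤ 1) :
    approxCost A B K c w t ((1 - l) • N + l • N') - approxCost A B K c w t N ≤
      2 * (G * (3 * Q ^ 7 * b)) * l := by
  have h1 := (approxCost_convex (A := A) (B := B) (K := K) hc w t).2 (Set.mem_univ N)
    (Set.mem_univ N') (sub_nonneg.2 hl1) hl (by ring)
  simp only [smul_eq_mul] at h1
  have h2 := neg_le_of_abs_le (abs_approxCost_le h ha haQ hw hc t hN)
  have h3 := le_of_abs_le (abs_approxCost_le h ha haQ hw hc t hN')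
  nlinarith

end DisturbanceAction

/-! ### Regret against one benchmark policy -/

section Regret

variable {H m n T : ℕ} {A : Matrix (Fin n) (Fin n) ℝ} {B : Matrix (Fin n) (Fin m) ℝ}
  {K K' Kss : Matrix (Fin m) (Fin n) ℝ} {X : Set (Vec n)} {U : Set (Vec m)}
  {wbar κ γ a Q b β G ε εstar η : ℝ} {c : ℕ → Vec n → Vec m → ℝ} {M0 : Weights H m n}
  {w : ℕ → Vec n}

lemma ogdBZC_eq : ogdBZC A B K wbar X U a γ ε η c M0 w =
    dacPolicy K (ogdWeights A B K wbar X U a γ ε η c M0 w) w := by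
  funext t x
  rw [ogdBZC, dacPolicy, dac, sum_Icc_one_eq_sum_range]

lemma ogdWeights_mem
    (hcl : IsClosed (safeSet A B K wbar X U a γ ε : Set (Weights H m n)))
    (hM0 : M0 ∈ safeSet A B K wbar X U a γ ε) (t : ℕ) :
    ogdWeights A B K wbar X U a γ ε η c M0 w t ∈ safeSet A B K wbar X U a γ ε := by
  cases t with
  | zero => exact hM0
  | succ t => exact (proj_mem_and_le hcl ⟨M0, hM0⟩ _).1

lemma norm_sub_le_of_norm_step_le {E : Type*} [SeminormedAddCommGroup E] {M : ℕ → E} {r : ℝ}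
    (hr : 0 ≤ r) (hM : ∀ t, ‖M (t + 1) - M t‖ ≤ r) {s t N : ℕ} (hst : s ≤ t) (hts : t ≤ s + N) :
    ‖M s - M t‖ ≤ N * r := by
  rw [← dist_eq_norm]
  calc dist (M s) (M t) ≤ ∑ _i ∈ Ico s t, r :=
        dist_le_Ico_sum_of_dist_le hst fun _ _ => by rw [dist_comm, dist_eq_norm]; exact hM _
    _ = ((t - s : ℕ) : ℝ) * r := by simp
    _ ≤ N * r := by
        gcongr
        omega

/-- State and input vanish at time zero, and so does the loss there. Only `T` of the `T + 1` rounds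
count, which gives bounds proportional to `T`. -/
lemma cumLoss_eq_sum_range (hc : LossAssumption c G) {π : ℕ → Vec n → Vec m} (h0 : π 0 0 = 0) :
    cumLoss A B c T w π =
      ∑ t ∈ range T, c (t + 1) (state A B w π (t + 1)) (input A B w π (t + 1)) := by
  rw [cumLoss, sum_range_succ', add_eq_left]
  show c 0 0 (π 0 0) = 0
  rw [h0, hc.zero]

lemma dacPolicy_zero (M : ℕ → Weights H m n) : dacPolicy K M w 0 0 = 0 := by
  simp only [dacPolicy, act_zero, neg_zero, zero_add]
  exact sum_eq_zero fun j _ => by rw [past_of_lt w (by omega), act_zero]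

lemma linPolicy_zero : linPolicy K 0 0 = 0 := by simp [linPolicy]

/-- The losses of any two policies under consideration differ by at most the range of losses. -/
lemma cumLoss_dacPolicy_sub_le (h : GainBound A B K (1 - γ) Q) (h' : GainBound A B K' (1 - γ) Q)
    (ha : 0 ≤ a) (haQ : a ≤ Q) {M : ℕ → Weights H m n} (hM : ∀ t, M t ∈ weightClass H m n a γ)
    (hw : ∀ t, ‖w t‖ ≤ b) (hc : LossAssumption c G) :
    cumLoss A B c T w (dacPolicy K M w) - cumLoss A B c T w (linPolicy K') ≤
      T * (2 * (G * (3 * Q ^ 7 * b))) := by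
  have hb := (norm_nonneg _).trans (hw 0)
  have hQ := h.Q_nonneg
  rw [cumLoss_eq_sum_range hc (dacPolicy_zero M), cumLoss_eq_sum_range hc linPolicy_zero,
    ← sum_sub_distrib]
  have hterm : ∀ t, c (t + 1) (state A B w (dacPolicy K M w) (t + 1))
      (input A B w (dacPolicy K M w) (t + 1)) - c (t + 1) (state A B w (linPolicy K') (t + 1))
      (input A B w (linPolicy K') (t + 1)) ≤ 2 * (G * (3 * Q ^ 7 * b)) := by
    intro t
    have e1 : Q ^ 3 * b ≤ 3 * Q ^ 7 * b := by
      have : Q ^ 3 ≤ Q ^ 7 := pow_le_pow_right₀ h.one_le (by norm_num)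
      nlinarith [pow_nonneg hQ 7]
    have e2 : Q ^ 4 * b ≤ 3 * Q ^ 7 * b := by
      have : Q ^ 4 ≤ Q ^ 7 := pow_le_pow_right₀ h.one_le (by norm_num)
      nlinarith [pow_nonneg hQ 7]
    have h1 := ((hc (t + 1)).2.2 _ _ _ ((h.norm_state_dacPolicy_le ha haQ hM hw (t + 1)).trans
      (two_mul_pow_six_le h.one_le hb)) (h.norm_input_dacPolicy_le ha haQ hM hw (t + 1))).1
    have h2 := ((hc (t + 1)).2.2 _ _ _ ((h'.norm_state_linPolicy_le hw (t + 1)).trans e1)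
      ((h'.norm_input_linPolicy_le hw (t + 1)).trans e2)).1
    linarith [le_of_abs_le h1, neg_le_of_abs_le h2]
  refine (sum_le_sum fun t _ => hterm t).trans ?_
  simp

/-- The regret of the algorithm against `K'` when a nearby safe comparator exists. -/
lemma cumLoss_ogd_sub_le (h : GainBound A B K (1 - γ) Q) (h' : GainBound A B K' (1 - γ) Q)
    (hγ : 0 ≤ γ) (ha : 0 ≤ a) (haQ : a ≤ Q) (hη : 0 < η)
    (hcl : IsClosed (safeSet A B K wbar X U a γ ε : Set (Weights H m n)))
    (hcv : Convex ℝ (safeSet A B K wbar X U a γ ε : Set (Weights H m n)))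
    (hM0 : M0 ∈ safeSet A B K wbar X U a γ ε) (hw : ∀ t, ‖w t‖ ≤ b) (hc : LossAssumption c G)
    {N : Weights H m n} {l : ℝ} (hl : 0 ≤ l) (hl1 : l ≤ 1)
    (hK' : imitation H A B K K' ∈ weightClass H m n a γ) (hN : N ∈ weightClass H m n a γ)
    (hmem : (1 - l) • imitation H A B K K' + l • N ∈ safeSet A B K wbar X U a γ ε) :
    cumLoss A B c T w (ogdBZC A B K wbar X U a γ ε η c M0 w) - cumLoss A B c T w (linPolicy K') ≤
      T * (G * (3 * Q ^ 7 * b) * (2 * Q * (Q ^ 4 * (H * b * (H * (η * (G * (3 * Q ^ 7 * b) *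
          (3 * Q ^ 5 * H * b))))) + 2 * Q ^ 6 * (1 - γ) ^ H * b))) +
        (4 * (m * Q ^ 3) / (2 * η) +
          T * (η * (G * (3 * Q ^ 7 * b) * (3 * Q ^ 5 * H * b)) ^ 2 / 2)) +
        T * (2 * (G * (3 * Q ^ 7 * b)) * l) +
        T * (G * (3 * Q ^ 7 * b) * (14 * Q ^ 9 * (1 - γ) ^ H * b)) := by
  have hb := (norm_nonneg _).trans (hw 0)
  have hQ := h.Q_nonneg
  have hG := hc.nonneg
  set M := ogdWeights A B K wbar X U a γ ε η c M0 w with hMdef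
  set p := (1 - l) • imitation H A B K K' + l • N
  set g : ℕ → Weights H m n := fun t => gradient (approxCost A B K c w t) (M t) with hgdef
  have hMmem : ∀ t, M t ∈ safeSet A B K wbar X U a γ ε := ogdWeights_mem hcl hM0
  have hMw : ∀ t, M t ∈ weightClass H m n a γ := fun t => (hMmem t).1
  have hg : ∀ t, ‖g t‖ ≤ G * (3 * Q ^ 7 * b) * (3 * Q ^ 5 * H * b) := fun t =>
    norm_gradient_approxCost_le h hc hw t
      (h.norm_surrState_le_of_mem ha haQ (hMw t) (norm_past_le hw t))
      (h.norm_surrInput_le_of_mem ha haQ (hMw t) (norm_past_le hw t))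
  have hstep : ∀ q ∈ safeSet A B K wbar X U a γ ε, ∀ t,
      ‖M (t + 1) - q‖ ≤ ‖M t - η • g t - q‖ := fun q hq t => norm_proj_sub_le hcl hcv _ hq
  have hmove : ∀ t, ‖M (t + 1) - M t‖ ≤ η * (G * (3 * Q ^ 7 * b) * (3 * Q ^ 5 * H * b)) := by
    intro t
    -- The current weight is itself feasible; taken as the target, it shows that projecting does not
    -- lengthen the step.
    refine (hstep _ (hMmem t) t).trans ?_
    rw [sub_right_comm, sub_self, zero_sub, norm_neg, norm_smul, Real.norm_of_nonneg hη.le]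
    gcongr
    exact hg t
  have hdiam : ‖M 1 - p‖ ^ 2 ≤ 4 * (m * Q ^ 3) := by
    have hnorm : ∀ q ∈ weightClass H m n a γ, ‖q‖ ^ 2 ≤ m * Q ^ 3 := by
      intro q hq
      calc _ ≤ m * a ^ 2 * Q :=
            norm_sq_le_of_mem_weightClass h.nonneg (by linarith) h.geom hq
        _ ≤ m * Q ^ 2 * Q := by gcongr
        _ = _ := by ring
    have h1 := hnorm _ (hMw 1)
    have h2 := hnorm _ hmem.1
    have h3 := parallelogram_law_with_norm ℝ (M 1) p
    nlinarith [mul_self_nonneg ‖M 1 + p‖]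
  -- Descent is started at round one, since round zero carries no loss; this is why the diameter
  -- bound concerns `M 1`.
  have hdescent := sum_inner_le_of_descent (M := fun t => M (t + 1)) (g := fun t => g (t + 1))
    (p := p) hη (fun t => hstep p hmem (t + 1)) (fun t => hg (t + 1)) T
  rw [ogdBZC_eq, cumLoss_eq_sum_range hc (dacPolicy_zero M), cumLoss_eq_sum_range hc linPolicy_zero,
    ← sum_sub_distrib]
  have hterm : ∀ t, c (t + 1) (state A B w (dacPolicy K M w) (t + 1))
      (input A B w (dacPolicy K M w) (t + 1)) - c (t + 1) (state A B w (linPolicy K') (t + 1))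
      (input A B w (linPolicy K') (t + 1)) ≤
      G * (3 * Q ^ 7 * b) * (2 * Q * (Q ^ 4 * (H * b * (H * (η * (G * (3 * Q ^ 7 * b) *
          (3 * Q ^ 5 * H * b))))) + 2 * Q ^ 6 * (1 - γ) ^ H * b)) + ⟪g (t + 1), M (t + 1) - p⟫ +
        2 * (G * (3 * Q ^ 7 * b)) * l +
        G * (3 * Q ^ 7 * b) * (14 * Q ^ 9 * (1 - γ) ^ H * b) := by
    intro t
    have h1 := cost_sub_approxCost_le h ha haQ hMw hw hc (t + 1) fun s hs hts =>
      norm_sub_le_of_norm_step_le (by positivity) hmove hs hts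
    have h2 := approxCost_sub_le_inner (A := A) (B := B) (K := K) hc w (t + 1) (M (t + 1)) p
    have h3 := approxCost_combination_sub_le h ha haQ hw hc (t + 1) hK' hN hl hl1
    have h4 := approxCost_imitation_sub_le h h' ha haQ hK' hw hc (t + 1)
    linarith
  refine (sum_le_sum fun t _ => hterm t).trans ?_
  simp only [sum_add_distrib, sum_const, card_range, nsmul_eq_mul]
  have h5 : ‖M (0 + 1) - p‖ ^ 2 / (2 * η) ≤ 4 * (m * Q ^ 3) / (2 * η) := by gcongr
  linarith

end Regret

/-! ### Reduction of the explicit bounds to the stated rates -/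

section Rates

variable {Q β N m T H r η ε εstar S : ℝ}

/-- In this part `β` stands for √n, `N` for n and `r` for (1 - γ)^H; the disturbance bound is `Q *
β`, and `G` is replaced by `Q`. -/
lemma mixing_rate_le (hQ : 1 ≤ Q) (hβ : 0 ≤ β) (hβN : β ^ 2 = N) (hT : 0 ≤ T) (hr : 0 ≤ r)
    (hε : 0 ≤ ε) (hεs : 0 < εstar) {S2 S3 : ℝ} (hS2 : N ≤ S2) (hS3 : β ≤ S3) :
    T * (2 * (Q * (3 * Q ^ 7 * (Q * β))) * ((ε + 7 * Q ^ 9 * r * (Q * β)) / εstar)) ≤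
      42 * Q ^ 30 * (T * r * S2 / εstar) + 6 * Q ^ 30 * (ε * T * S3 / εstar) := by
  have h9 : Q ^ 9 ≤ Q ^ 30 := pow_le_pow_right₀ hQ (by norm_num)
  have h19 : Q ^ 19 ≤ Q ^ 30 := pow_le_pow_right₀ hQ (by norm_num)
  have hN : 0 ≤ N := hβN ▸ sq_nonneg β
  calc _ = 42 * Q ^ 19 * (T * r * β ^ 2 / εstar) + 6 * Q ^ 9 * (ε * T * β / εstar) := by ring
    _ ≤ _ := by rw [hβN]; gcongr

/-- The exponent 30 is attained by the drift of the weights over the memory and by the squared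
gradients in the descent bound. -/
lemma memory_rate_le (hQ : 1 ≤ Q) (hβN : β ^ 2 = N) (hT : 0 ≤ T) (hH : 1 ≤ H)
    (hm : 1 ≤ m) (hr : 0 ≤ r) (hη : 0 < η) {S1 : ℝ} (hS1 : N ≤ S1) :
    T * (Q * (3 * Q ^ 7 * (Q * β)) * (2 * Q * (Q ^ 4 * (H * (Q * β) * (H * (η *
        (Q * (3 * Q ^ 7 * (Q * β)) * (3 * Q ^ 5 * H * (Q * β)))))) + 2 * Q ^ 6 * r * (Q * β)))) +
      (4 * (m * Q ^ 3) / (2 * η) +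
        T * (η * (Q * (3 * Q ^ 7 * (Q * β)) * (3 * Q ^ 5 * H * (Q * β))) ^ 2 / 2)) +
      T * (Q * (3 * Q ^ 7 * (Q * β)) * (14 * Q ^ 9 * r * (Q * β))) ≤
    54 * Q ^ 30 * (T * S1 * H ^ 2 * r) + 95 * Q ^ 30 * (T * m * N ^ 2 * H ^ 3 * η) +
      2 * Q ^ 30 * (m / η) := by
  have h3 : Q ^ 3 ≤ Q ^ 30 := pow_le_pow_right₀ hQ (by norm_num)
  have h17 : Q ^ 17 ≤ Q ^ 30 := pow_le_pow_right₀ hQ (by norm_num)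
  have h19 : Q ^ 19 ≤ Q ^ 30 := pow_le_pow_right₀ hQ (by norm_num)
  have hQ0 : 0 ≤ Q ^ 30 := by positivity
  have hN : 0 ≤ N := hβN ▸ sq_nonneg β
  have e1 : T * N * r ≤ T * S1 * H ^ 2 * r := by
    have : 1 ≤ H ^ 2 := one_le_pow₀ hH
    have h1 : 0 ≤ T * S1 := mul_nonneg hT (hN.trans hS1)
    exact mul_le_mul_of_nonneg_right ((mul_le_mul_of_nonneg_left hS1 hT).trans
      (le_mul_of_one_le_right h1 this)) hr
  have e2 : T * N ^ 2 * H ^ 3 * η ≤ T * m * N ^ 2 * H ^ 3 * η := by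
    gcongr
    exact le_mul_of_one_le_right hT hm
  have e3 : T * N ^ 2 * H ^ 2 * η ≤ T * m * N ^ 2 * H ^ 3 * η := by
    refine le_trans ?_ e2
    gcongr
    norm_num
  have e0 : 0 ≤ T * N * r := by positivity
  have e4 : 0 ≤ T * N ^ 2 * H ^ 2 * η := by positivity
  have e5 : 0 ≤ m / η := by positivity
  calc _ = 54 * Q ^ 30 * (T * (β ^ 2) ^ 2 * H ^ 3 * η) + 12 * Q ^ 17 * (T * β ^ 2 * r) +
        2 * Q ^ 3 * (m / η) + 81 / 2 * Q ^ 30 * (T * (β ^ 2) ^ 2 * H ^ 2 * η) +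
        42 * Q ^ 19 * (T * β ^ 2 * r) := by field_simp; ring
    _ ≤ 54 * Q ^ 30 * (T * m * N ^ 2 * H ^ 3 * η) + 12 * Q ^ 30 * (T * S1 * H ^ 2 * r) +
        2 * Q ^ 30 * (m / η) + 41 * Q ^ 30 * (T * m * N ^ 2 * H ^ 3 * η) +
        42 * Q ^ 30 * (T * S1 * H ^ 2 * r) := by
      rw [hβN]
      gcongr
      norm_num
    _ = _ := by ring

/-- On short horizons the step-size terms dominate the trivial bound. -/
lemma short_horizon_rate_le (hQ : 1 ≤ Q) (hβ : 0 ≤ β) (hβN : β ^ 2 = N) (hT : 0 ≤ T) (hH : 1 ≤ H)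
    (hm : 1 ≤ m) (hN : 1 ≤ N) (hη : 0 < η) (hTH : T ≤ 2 * H) :
    T * (2 * (Q * (3 * Q ^ 7 * (Q * β)))) ≤
      6 * Q ^ 30 * (T * m * N ^ 2 * H ^ 3 * η) + 6 * Q ^ 30 * (m / η) := by
  have h9 : Q ^ 9 ≤ Q ^ 30 := pow_le_pow_right₀ hQ (by norm_num)
  -- The product of the two right-hand terms is free of `η`; with `T ≤ 2 * H`, twice that product
  -- dominates `(T * β) ^ 2`.
  have key : T * β ≤ T * m * N ^ 2 * H ^ 3 * η + m / η := by
    refine le_of_sq_le_sq ?_ (by positivity)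
    have h1 : T * N ≤ T * m * N ^ 2 * H ^ 3 * m / H := by
      rw [le_div_iff₀ (by positivity)]
      calc T * N * H = T * 1 * N * H * 1 := by ring
        _ ≤ T * m * N ^ 2 * H ^ 3 * m := by
          gcongr
          · exact le_self_pow₀ hN (by norm_num)
          · exact le_self_pow₀ hH (by norm_num)
    have h2 : (T * m * N ^ 2 * H ^ 3 * η) * (m / η) = T * m * N ^ 2 * H ^ 3 * m / H * H := by
      field_simp
    calc (T * β) ^ 2 = T * (T * N) := by rw [mul_pow, hβN]; ring
      _ ≤ (2 * H) * (T * m * N ^ 2 * H ^ 3 * m / H) := by gcongr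
      _ = 2 * ((T * m * N ^ 2 * H ^ 3 * η) * (m / η)) := by rw [h2]; ring
      _ ≤ _ := by
        nlinarith [sq_nonneg (T * m * N ^ 2 * H ^ 3 * η), sq_nonneg (m / η)]
  calc _ = 6 * Q ^ 9 * (T * β) := by ring
    _ ≤ 6 * Q ^ 30 * (T * m * N ^ 2 * H ^ 3 * η + m / η) := by gcongr
    _ = _ := by ring

end Rates

/-! ### Assembly of the cases -/

section Regret

variable {H n m T : ℕ} {A : Matrix (Fin n) (Fin n) ℝ} {B : Matrix (Fin n) (Fin m) ℝ}
  {K K' Kss : Matrix (Fin m) (Fin n) ℝ} {X : Set (Vec n)} {U : Set (Vec m)}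
  {wbar κ γ a Q G ε εstar η : ℝ} {c : ℕ → Vec n → Vec m → ℝ} {M0 : Weights H m n}
  {w : ℕ → Vec n}

lemma LossAssumption.mono (hc : LossAssumption c G) {G' : ℝ} (hG : G ≤ G') :
    LossAssumption c G' := fun t =>
  ⟨(hc t).1, (hc t).2.1, fun D x u hx hu => by
    obtain ⟨h1, h2, h3⟩ := (hc t).2.2 D x u hx hu
    have := mul_le_mul_of_nonneg_right hG ((norm_nonneg x).trans hx)
    exact ⟨h1.trans this, h2.trans this, h3.trans this⟩⟩

lemma cumLoss_ogdBZC_sub_le (hn : 1 ≤ n) (hm : 1 ≤ m) (hH : 1 ≤ H)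
    (hQ : 1 ≤ Q) (hwbar : 0 ≤ wbar) (hκ : 1 < κ) (hγ : 0 < γ) (hγ1 : γ ≤ 1) (ha : 2 * κ ^ 3 ≤ a)
    (hη : 0 < η) (hwQ : wbar ≤ Q) (hGQ : G ≤ Q) (hκQ : κ ≤ Q) (hBQ : kappaB B ≤ Q) (haQ : a ≤ Q)
    (hγQ : γ⁻¹ ≤ Q) (hXcl : IsClosed X) (hX : Convex ℝ X) (hUcl : IsClosed U) (hU : Convex ℝ U)
    (hc : LossAssumption c G) (hεs : 0 < εstar) (hKss : Kss ∈ safeLinear A B wbar X U κ γ T)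
    (hsafe : StrictlySafe A B wbar X U εstar Kss) (hK : StronglyStable A B κ γ K)
    (hM0 : M0 ∈ safeSet A B K wbar X U a γ ε) (hε : 0 ≤ ε) (hw : w ∈ Disturbances n wbar)
    (hK' : K' ∈ safeLinear A B wbar X U κ γ T) :
    cumLoss A B c T w (ogdBZC A B K wbar X U a γ ε η c M0 w) - cumLoss A B c T w (linPolicy K') ≤
      100 * Q ^ 30 * ((T : ℝ) * Real.sqrt ((m : ℝ) ^ 2 * (n : ℝ) ^ 3) * (H : ℝ) ^ 2 * (1 - γ) ^ H
        + (T : ℝ) * (m : ℝ) * (n : ℝ) ^ 2 * (H : ℝ) ^ 3 * η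
        + (m : ℝ) / η
        + (T : ℝ) * (1 - γ) ^ H * Real.sqrt ((m : ℝ) ^ 2 * (n : ℝ) ^ 3 * (H : ℝ) ^ 5) / εstar
        + ε * (T : ℝ) * Real.sqrt ((m : ℝ) ^ 2 * (n : ℝ) ^ 2 * (H : ℝ) ^ 3) / εstar) := by
  have hQ0 : 0 ≤ Q := by linarith
  have ha0 : 0 ≤ a := le_trans (by positivity) ha
  have hγ' : 0 ≤ 1 - γ := by linarith
  have hr : 0 ≤ (1 - γ) ^ H := pow_nonneg hγ' H
  have gain : ∀ {K''}, StronglyStable A B κ γ K'' → GainBound A B K'' (1 - γ) Q :=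
    fun h => h.gainBound hQ hγ hγ1 hκ hκQ hγQ hBQ
  have hcQ := hc.mono hGQ
  have hbox : ∀ y ∈ boxBall n wbar, ‖y‖ ≤ Q * Real.sqrt n := fun y hy =>
    (norm_le_of_mem_boxBall hwbar hy).trans (by rw [mul_comm]; gcongr)
  have hwb : ∀ t, ‖w t‖ ≤ Q * Real.sqrt n := fun t => hbox _ (hw t)
  have hn' : (1 : ℝ) ≤ n := by exact_mod_cast hn
  have hm' : (1 : ℝ) ≤ m := by exact_mod_cast hm
  have hH' : (1 : ℝ) ≤ H := by exact_mod_cast hH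
  have hβ : Real.sqrt n ^ 2 = n := Real.sq_sqrt (by positivity)
  have hm2 : (1 : ℝ) ≤ (m : ℝ) ^ 2 := one_le_pow₀ hm'
  have hS1 : (n : ℝ) ≤ Real.sqrt ((m : ℝ) ^ 2 * (n : ℝ) ^ 3) := by
    refine Real.le_sqrt_of_sq_le ?_
    calc (n : ℝ) ^ 2 = 1 * (n : ℝ) ^ 2 := by ring
      _ ≤ _ := by gcongr; norm_num
  have hS2 : (n : ℝ) ≤ Real.sqrt ((m : ℝ) ^ 2 * (n : ℝ) ^ 3 * (H : ℝ) ^ 5) :=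
    hS1.trans (Real.sqrt_le_sqrt (le_mul_of_one_le_right (by positivity) (one_le_pow₀ hH')))
  have hS3 : Real.sqrt n ≤ Real.sqrt ((m : ℝ) ^ 2 * (n : ℝ) ^ 2 * (H : ℝ) ^ 3) := by
    refine Real.sqrt_le_sqrt ?_
    calc (n : ℝ) = 1 * (n : ℝ) * 1 := by ring
      _ ≤ _ := by
        gcongr
        · exact le_self_pow₀ hn' (by norm_num)
        · exact one_le_pow₀ hH'
  have hcl : IsClosed (safeSet A B K wbar X U a γ ε : Set (Weights H m n)) :=
    isClosed_safeSet ha0 hγ' hε hXcl hUcl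
  have hcv : Convex ℝ (safeSet A B K wbar X U a γ ε : Set (Weights H m n)) :=
    convex_safeSet ha0 hγ' hε hX hU
  have hT0 : (0 : ℝ) ≤ T := by positivity
  have htriv := cumLoss_dacPolicy_sub_le (T := T) (gain hK) (gain hK'.1) ha0 haQ
    (fun t => (ogdWeights_mem (η := η) (c := c) (w := w) hcl hM0 t).1) hwb hcQ
  rw [← ogdBZC_eq] at htriv
  have hmix := mixing_rate_le (T := T) hQ (Real.sqrt_nonneg n) hβ hT0 hr hε hεs hS2 hS3
  set D := cumLoss A B c T w (ogdBZC A B K wbar X U a γ ε η c M0 w) -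
    cumLoss A B c T w (linPolicy K')
  set l := (ε + 7 * Q ^ 9 * (1 - γ) ^ H * (Q * Real.sqrt n)) / εstar with hl_def
  have hQ30 : 0 ≤ Q ^ 30 := by positivity
  have n1 : 0 ≤ Q ^ 30 * ((T : ℝ) * Real.sqrt ((m : ℝ) ^ 2 * (n : ℝ) ^ 3) * (H : ℝ) ^ 2 *
    (1 - γ) ^ H) := by positivity
  have n2 : 0 ≤ Q ^ 30 * ((T : ℝ) * (m : ℝ) * (n : ℝ) ^ 2 * (H : ℝ) ^ 3 * η) := by positivity
  have n3 : 0 ≤ Q ^ 30 * ((m : ℝ) / η) := by positivity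
  have n4 : 0 ≤ Q ^ 30 * ((T : ℝ) * (1 - γ) ^ H *
    Real.sqrt ((m : ℝ) ^ 2 * (n : ℝ) ^ 3 * (H : ℝ) ^ 5) / εstar) := by positivity
  have n5 : 0 ≤ Q ^ 30 * (ε * (T : ℝ) *
    Real.sqrt ((m : ℝ) ^ 2 * (n : ℝ) ^ 2 * (H : ℝ) ^ 3) / εstar) := by positivity
  rcases lt_or_ge T (2 * H) with hTH | hTH
  -- `K'` is not known to be safe for a full window of length `2 * H`, so the crude bound is used.
  · have hTH' : (T : ℝ) ≤ 2 * H := by exact_mod_cast hTH.le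
    have := short_horizon_rate_le hQ (Real.sqrt_nonneg n) hβ hT0 hH' hm' hn' hη hTH'
    linarith
  have hl : 0 ≤ l := by positivity
  rcases le_or_gt l 1 with hl1 | hl1
  · have hmem := imitation_combination_mem_safeSet hX hU ha ha0 hbox hK (gain hK) hK'
      (gain hK'.1) hKss.1 (gain hKss.1) hsafe hTH hε hl hl1
      (by rw [hl_def, div_mul_cancel₀ _ hεs.ne'])
    have h1 := cumLoss_ogd_sub_le (T := T) (gain hK) (gain hK'.1) hγ.le ha0 haQ hη hcl hcv hM0 hwb
      hcQ hl hl1 (imitation_mem_weightClass hK hK'.1 ha) (imitation_mem_weightClass hK hKss.1 ha)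
      hmem
    have h2 := memory_rate_le (T := T) hQ hβ hT0 hH' hm' hr hη hS1
    linarith
  -- A proportion above one is no convex combination, but then the mixing cost already exceeds the
  -- crude bound.
  · have h1 : (T : ℝ) * (2 * (Q * (3 * Q ^ 7 * (Q * Real.sqrt n)))) ≤
        T * (2 * (Q * (3 * Q ^ 7 * (Q * Real.sqrt n))) * l) := by
      exact mul_le_mul_of_nonneg_left (le_mul_of_one_le_right (by positivity) hl1.le) hT0
    linarith

end Regret

end OGDBZC

theorem theorem2 :
    -- one polynomial in `w̄, G, κ, κ_B, a, γ⁻¹`, chosen before all data of the problem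
    ∃ P : MvPolynomial (Fin 6) ℝ,
      ∀ (n m H T : ℕ), 1 ≤ n → 1 ≤ m → 1 ≤ H →
      ∀ (A : Matrix (Fin n) (Fin n) ℝ) (B : Matrix (Fin n) (Fin m) ℝ)
        (K : Matrix (Fin m) (Fin n) ℝ)
        (X : Set (Vec n)) (U : Set (Vec m)) (c : ℕ → Vec n → Vec m → ℝ)
        (wbar G κ γ a ε εstar η : ℝ) (M0 : Weights H m n),
      0 ≤ wbar → 1 < κ → 0 < γ → γ ≤ 1 → 2 * κ ^ 3 ≤ a → 0 < η →
      -- the constraint sets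
      IsClosed X → Convex ℝ X → (0 : Vec n) ∈ X →
      IsClosed U → Convex ℝ U → (0 : Vec m) ∈ U →
      -- the losses
      LossAssumption c G →
      -- existence of a strictly safe linear policy
      0 < εstar →
      (∃ Kss ∈ safeLinear A B wbar X U κ γ T, StrictlySafe A B wbar X U εstar Kss) →
      -- the inputs of the algorithm
      StronglyStable A B κ γ K →
      M0 ∈ safeSet A B K wbar X U a γ ε →
      -- the conditions on memory and buffer size
      0 ≤ ε →
      Real.log (2 * κ ^ 2) / Real.log ((1 - γ)⁻¹) ≤ (H : ℝ) →
      eps1 wbar κ (kappaB B) a γ H + eps2 n m wbar G κ (kappaB B) a γ η H ≤ ε →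
      ε ≤ εstar - eps1 wbar κ (kappaB B) a γ H - eps3 n wbar κ γ H →
      ε < εstar / 2 - eps1 wbar κ (kappaB B) a γ H - eps3 n wbar κ γ H →
      -- the regret bound
      regret A B wbar X U κ γ c T (ogdBZC A B K wbar X U a γ ε η c M0) ≤
        ((MvPolynomial.eval ![wbar, G, κ, kappaB B, a, γ⁻¹] P *
          ((T : ℝ) * Real.sqrt ((m : ℝ) ^ 2 * (n : ℝ) ^ 3) * (H : ℝ) ^ 2 * (1 - γ) ^ H
            + (T : ℝ) * (m : ℝ) * (n : ℝ) ^ 2 * (H : ℝ) ^ 3 * η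
            + (m : ℝ) / η
            + (T : ℝ) * (1 - γ) ^ H
                * Real.sqrt ((m : ℝ) ^ 2 * (n : ℝ) ^ 3 * (H : ℝ) ^ 5) / εstar
            + ε * (T : ℝ) * Real.sqrt ((m : ℝ) ^ 2 * (n : ℝ) ^ 2 * (H : ℝ) ^ 3) / εstar) :
          ℝ) : EReal) := by
  -- All six parameters are nonnegative, so one plus their sum dominates each of them and 1, as
  -- required of `Q`.
  refine ⟨MvPolynomial.C 100 * (1 + ∑ i, MvPolynomial.X i) ^ 30, ?_⟩
  intro n m H T hn hm hH A B K X U c wbar G κ γ a ε εstar η M0 hwbar hκ hγ hγ1 ha hη hXcl hX _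
    hUcl hU _ hc hεs ⟨Kss, hKss, hsafe⟩ hK hM0 hε _ _ _ _
  have hP : MvPolynomial.eval ![wbar, G, κ, kappaB B, a, γ⁻¹]
      (MvPolynomial.C 100 * (1 + ∑ i, MvPolynomial.X i) ^ 30) =
      100 * (1 + (wbar + G + κ + kappaB B + a + γ⁻¹)) ^ 30 := by
    rw [map_mul, map_pow, MvPolynomial.eval_C]
    congr 2
    simp [Fin.sum_univ_six]
  have hG : 0 ≤ G := hc.nonneg
  have hB : 0 ≤ kappaB B := zero_le_one.trans (le_max_right _ _)
  have ha0 : 0 ≤ a := le_trans (by positivity) ha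
  have hγi : 0 ≤ γ⁻¹ := by positivity
  obtain ⟨Q, hQ⟩ : ∃ Q, Q = 1 + (wbar + G + κ + kappaB B + a + γ⁻¹) := ⟨_, rfl⟩
  rw [hP, ← hQ]
  clear hP
  refine iSup₂_le fun w hw => EReal.sub_le_of_le_add' ?_
  -- Finiteness of the bound allows it to be moved across, leaving the infimum alone on the right,
  -- to be tested on each benchmark policy.
  rw [← EReal.sub_le_iff_le_add (Or.inl (EReal.coe_ne_bot _)) (Or.inl (EReal.coe_ne_top _))]
  refine le_iInf₂ fun K' hK' => ?_
  have key := cumLoss_ogdBZC_sub_le (Q := Q) (w := w) (K' := K') (η := η) hn hm hH (by linarith)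
    hwbar hκ hγ hγ1 ha hη (by linarith) (by linarith) (by linarith) (by linarith) (by linarith)
    (by linarith) hXcl hX hUcl hU hc hεs hKss hsafe hK hM0 hε hw hK'
  rw [← EReal.coe_sub, EReal.coe_le_coe_iff]
  exact sub_le_comm.1 key
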